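/- Let $N\ge 1$ and $\mathbb Z_N=\mathbb Z/N\mathbb Z$. On $\ell^2(\mathbb Z\times\{0,1\}\times\mathbb Z_N)$ consider, for a bounded real sequence $v=(v_n)_{n\in\mathbb Z}$, the tight-binding Schrödinger operators (without magnetic field) of the armchair and of the zigzag nanotube, $$(H_{ar}(v)f)_{n,0,k}=f_{n+1,1,k}+f_{n-1,1,k-1}+f_{n,1,k}+v_{2n}f_{n,0,k},$$ $$(H_{ar}(v)f)_{n,1,k}=f_{n+1,0,k+1}+f_{n-1,0,k}+f_{n,0,k}+v_{2n+1}f_{n,1,k},$$ $$(H_{zi}(v)f)_{n,0,k}=f_{n-1,1,k}+f_{n-1,1,k-1}+f_{n,1,k}+v_{2n+1}f_{n,0,k},$$ $$(H_{zi}(v)f)_{n,1,k}=f_{n+1,0,k+1}+f_{n+1,0,k}+f_{n,0,k}+v_{2n+2}f_{n,1,k}.$$ For $\alpha>0$ and $p\ge 1$ let $G_{ar}=G_{ar}(p,\alpha)$ be the maximal possible number of open gaps of $\sigma(H_{ar}(v))\cap[-3,-3+\alpha]$ (nonempty bounded intervals $(a,b)$ with $a,b\in\sigma(H_{ar}(v))\cap[-3,-3+\alpha]$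 and $(a,b)\cap\sigma(H_{ar}(v))=\emptyset$) over small real potentials $v$ of period $2p$ ($v_{n+2p}=v_n$ for all $n$): for all sufficiently small $\varepsilon>0$ (depending on $p$, $\alpha$, $N$) it is the maximum over all such $v$ with $\sup_n|v_n|\le\varepsilon$. Define $G_{zi}=G_{zi}(p,\alpha)$ in the same way with $H_{zi}$. Then there is $\alpha_0=\alpha_0(N)>0$ such that for every $\alpha\in(0,\alpha_0)$ the numbers $G_{ar},G_{zi}$ are well defined for all $p\ge1$ and, as $p\to\infty$, $$G_{ar}=\frac p\pi\arccos\Bigl(1-\frac\alpha2\Bigr)+o(p),\qquad G_{zi}=\frac p\pi\arccos\Bigl(1-\frac{6\alpha-\alpha^2}{4}\Bigr)+o(p).$$ -/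

import Mathlib

open Set Filter Topology Asymptotics
open scoped ENNReal

noncomputable section

namespace Nanotube

/-- Labels `(n, j, k)` of the atoms of the tube: `n` is the axial position, `j = 0, 1` the type of
the atom, and `k` the position around the tube. -/
abbrev Vertex (N : ℕ) : Type := ℤ × Fin 2 × ZMod N

/-- The complex Hilbert space `ℓ²(ι)`. -/
abbrev L2 (ι : Type) : Type := lp (fun _ : ι => ℂ) 2

/-- Bounded real sequences `(v n)`, `n ∈ ℤ`, with the supremum norm. -/
abbrev BddSeq : Type := lp (fun _ : ℤ => ℝ) ∞

section Operators

variable {ι : Type}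

lemma norm_sq_eq_tsum (f : L2 ι) : ‖f‖ ^ 2 = ∑' i, ‖f i‖ ^ 2 := by
  have h := lp.norm_rpow_eq_tsum (p := 2) (by norm_num) f
  simpa using h

lemma summable_norm_sq (f : L2 ι) : Summable fun i => ‖f i‖ ^ 2 := by
  have h := (lp.memℓp f).summable (by norm_num)
  simpa using h

lemma memlp_of_summable {f : ι → ℂ} (h : Summable fun i => ‖f i‖ ^ 2) :
    Memℓp f 2 := by
  refine memℓp_gen ?_
  simpa using h

/-- The operator `(T f)(i) = f (σ i)` on `ℓ²(ι)`, for a permutation `σ` of `ι`. -/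
def permOp (σ : Equiv.Perm ι) : L2 ι →L[ℂ] L2 ι :=
  LinearMap.mkContinuous
    { toFun := fun f => ⟨fun i => f (σ i), memlp_of_summable
        ((Equiv.summable_iff σ (f := fun i => ‖f i‖ ^ 2)).2 (summable_norm_sq f))⟩
      map_add' := fun f g => by ext i; rfl
      map_smul' := fun c f => by ext i; rfl }
    1 (fun f => by
      rw [one_mul]
      refine le_of_eq ((sq_eq_sq₀ (norm_nonneg _) (norm_nonneg _)).1 ?_)
      rw [norm_sq_eq_tsum, norm_sq_eq_tsum]
      exact Equiv.tsum_eq σ (fun i => ‖f i‖ ^ 2))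

@[simp] lemma permOp_apply (σ : Equiv.Perm ι) (f : L2 ι) (i : ι) : permOp σ f i = f (σ i) := rfl

lemma norm_mul_sq_le (v : BddSeq) (c : ι → ℤ) (f : L2 ι) (i : ι) :
    ‖(v (c i) : ℂ) * f i‖ ^ 2 ≤ ‖v‖ ^ 2 * ‖f i‖ ^ 2 := by
  rw [norm_mul, mul_pow]
  have h : ‖((v (c i) : ℝ) : ℂ)‖ ≤ ‖v‖ := by
    rw [Complex.norm_real]
    exact lp.norm_apply_le_norm (by simp) v (c i)
  gcongr

lemma summable_mul_sq (v : BddSeq) (c : ι → ℤ) (f : L2 ι) :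
    Summable fun i => ‖(v (c i) : ℂ) * f i‖ ^ 2 :=
  Summable.of_nonneg_of_le (fun _ => by positivity) (norm_mul_sq_le v c f)
    ((summable_norm_sq f).mul_left _)

/-- The operator `(T f)(i) = v (c i) f(i)` on `ℓ²(ι)`, for a bounded real sequence `v` and a map
`c : ι → ℤ`. -/
def diagOp (v : BddSeq) (c : ι → ℤ) : L2 ι →L[ℂ] L2 ι :=
  LinearMap.mkContinuous
    { toFun := fun f => ⟨fun i => (v (c i) : ℂ) * f i, memlp_of_summable (summable_mul_sq v c f)⟩
      map_add' := fun f g => by ext i; exact mul_add _ _ _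
      map_smul' := fun a f => by ext i; exact mul_left_comm _ _ _ }
    ‖v‖ (fun f => by
      refine (sq_le_sq₀ (norm_nonneg _) (by positivity)).1 ?_
      rw [norm_sq_eq_tsum, mul_pow, norm_sq_eq_tsum f, ← tsum_mul_left]
      exact (summable_mul_sq v c f).tsum_le_tsum (norm_mul_sq_le v c f)
        ((summable_norm_sq f).mul_left _))

@[simp] lemma diagOp_apply (v : BddSeq) (c : ι → ℤ) (f : L2 ι) (i : ι) :
    diagOp v c f i = (v (c i) : ℂ) * f i := rfl

end Operators

section Tubes

variable (N : ℕ)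

/-- The involution of the vertex set that exchanges `(n, 0, k)` and `(n + s, 1, k + t)`. -/
def bond (s : ℤ) (t : ZMod N) : Equiv.Perm (Vertex N) :=
  Function.Involutive.toPerm
    (fun ω => if ω.2.1 = 0 then (ω.1 + s, 1, ω.2.2 + t) else (ω.1 - s, 0, ω.2.2 - t))
    (by
      rintro ⟨n, j, k⟩
      fin_cases j <;> simp)

/-- The tight-binding Hamiltonian of the zigzag tube without magnetic field: `H = H₀ + V`, with
`V` equal to `v (2n + 1)` at `(n, 0, k)` and to `v (2n)` at `(n - 1, 1, k)`. The two lemmas below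
spell it out. -/
def zigzagHamiltonian (v : BddSeq) : L2 (Vertex N) →L[ℂ] L2 (Vertex N) :=
  permOp (bond N (-1) 0) + permOp (bond N (-1) (-1)) + permOp (bond N 0 0)
    + diagOp v (fun ω => if ω.2.1 = 0 then 2 * ω.1 + 1 else 2 * (ω.1 + 1))

lemma zigzagHamiltonian_apply_zero (v : BddSeq) (f : L2 (Vertex N)) (n : ℤ) (k : ZMod N) :
    zigzagHamiltonian N v f (n, 0, k) =
      f (n - 1, 1, k) + f (n - 1, 1, k - 1) + f (n, 1, k) + v (2 * n + 1) * f (n, 0, k) := by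
  simp [zigzagHamiltonian, bond, sub_eq_add_neg]

lemma zigzagHamiltonian_apply_one (v : BddSeq) (f : L2 (Vertex N)) (n : ℤ) (k : ZMod N) :
    zigzagHamiltonian N v f (n, 1, k) =
      f (n + 1, 0, k) + f (n + 1, 0, k + 1) + f (n, 0, k) + v (2 * (n + 1)) * f (n, 1, k) := by
  simp [zigzagHamiltonian, bond]

/-- The tight-binding Hamiltonian of the armchair tube without magnetic field: `H = H₀ + V`, with
`V` equal to `v (2n)` at `(n, 0, k)` and to `v (2n + 1)` at `(n, 1, k)`. The two lemmas below
spell it out. -/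
def armchairHamiltonian (v : BddSeq) : L2 (Vertex N) →L[ℂ] L2 (Vertex N) :=
  permOp (bond N 1 0) + permOp (bond N (-1) (-1)) + permOp (bond N 0 0)
    + diagOp v (fun ω => if ω.2.1 = 0 then 2 * ω.1 else 2 * ω.1 + 1)

lemma armchairHamiltonian_apply_zero (v : BddSeq) (f : L2 (Vertex N)) (n : ℤ) (k : ZMod N) :
    armchairHamiltonian N v f (n, 0, k) =
      f (n + 1, 1, k) + f (n - 1, 1, k - 1) + f (n, 1, k) + v (2 * n) * f (n, 0, k) := by
  simp [armchairHamiltonian, bond, sub_eq_add_neg]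

lemma armchairHamiltonian_apply_one (v : BddSeq) (f : L2 (Vertex N)) (n : ℤ) (k : ZMod N) :
    armchairHamiltonian N v f (n, 1, k) =
      f (n - 1, 0, k) + f (n + 1, 0, k + 1) + f (n, 0, k) + v (2 * n + 1) * f (n, 1, k) := by
  simp [armchairHamiltonian, bond]

end Tubes

/-- The real points of the spectrum (all of it, for the self-adjoint operators above). -/
def realSpectrum {ι : Type} (T : L2 ι →L[ℂ] L2 ι) : Set ℝ :=
  {x : ℝ | (x : ℂ) ∈ spectrum ℂ T}

/-- The open gaps of a closed set `S` of reals inside `[lo, hi]`: the nonempty open intervals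
`(a, b)`, recorded as pairs `(a, b)`, that do not meet `S` and whose endpoints lie in
`S ∩ [lo, hi]`. -/
def openGaps (S : Set ℝ) (lo hi : ℝ) : Set (ℝ × ℝ) :=
  {I | I.1 < I.2 ∧ I.1 ∈ S ∩ Icc lo hi ∧ I.2 ∈ S ∩ Icc lo hi ∧ Disjoint (Ioo I.1 I.2) S}

/-- For a family `H v` of operators indexed by the potential `v`: `G` is the maximal possible
number of open gaps of the spectrum of `H v` in `[-3, -3 + α]` for small potentials of period `2p`,
that is, for every small enough `ε > 0`, the number `G` is the maximum over all real
`2p`-periodic `v` with `‖v‖ ≤ ε`. -/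
def IsMaxEdgeGapNumber {ι : Type} (H : BddSeq → (L2 ι →L[ℂ] L2 ι)) (p : ℕ) (α : ℝ) (G : ℕ) :
    Prop :=
  ∃ ε₀ : ℝ, 0 < ε₀ ∧ ∀ ε : ℝ, 0 < ε → ε ≤ ε₀ →
    IsGreatest {m : ℕ∞ | ∃ v : BddSeq, (∀ n : ℤ, v (n + 2 * (p : ℤ)) = v n) ∧ ‖v‖ ≤ ε ∧
      m = (openGaps (realSpectrum (H v)) (-3) (-3 + α)).encard} (G : ℕ∞)

end Nanotube

end

/-! With a potential of period `2p` the tube is periodic along its axis with period `p`, so its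
spectrum is the union over quasimomenta `κ` of the spectra of finite Hermitian operators `bloch t V₀
V₁ κ`. Without potential these couple the two sublattices by a hopping operator, diagonal in plane
waves, and the low energies are `-‖symbol‖`. A mode with zero mean around the tube loses a fixed
amount of hopping amplitude (`norm_hop_le`), so energies below `-3 + loss N` belong, for small
potentials, to functions constant around the tube. There the problem is one-dimensional, with
dispersion `-1 - 2 cos θ` (armchair) or `-√(5 + 4 cos θ)` (zigzag). Equating these to `-3 + α` gives
the angle `φ` whose cosine is `1 - α/2`, respectively `1 - (6α - α²)/4`.

Upper bound: eigenvalues move continuously with `κ` and cannot cross a gap, so any two gaps are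
separated by an eigenvalue at `κ = 0` (`exists_eigenvalue_between`). For small potentials a min-max
argument bounds the number of those below `-3 + α` by the number of plane waves with `‖symbol‖ ≥ 3 -
α` (`encard_openGaps_tube_le`), that is, of `l` mod `p` with `cos (2πl/p) ≥ cos φ`; this is at most
`pφ/π + 2`.

Lower bound: an arbitrarily small comb of period `p` turns the one-dimensional problem into a
Kronig–Penney model. The waves `sin (nθ)` with `θ = πj/p` vanish on the comb, so their energies stay
in the spectrum; for slightly larger `θ` the discriminant exceeds `2` in absolute value and the
energy lies in a gap (`eq_zero_of_kronigPenney`). This yields at least `⌊pφ/π⌋ - 1` gaps.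

Both bounds hold for all small `ε`, so the maximum stabilizes as `ε` decreases
(`exists_isMaxEdgeGapNumber`) and differs from `pφ/π` by a bounded amount. -/

noncomputable section

namespace Nanotube

/-! ### Self-adjoint operators: resolvent bounds, continuity and counting of eigenvalues. -/

section Abstract

variable {H : Type*} [NormedAddCommGroup H] [InnerProductSpace ℂ H]

/-- The lower bound gives injectivity and closed range. By self-adjointness the orthogonal
complement of the range is the kernel, hence zero, so the range is everything. -/
lemma notMem_spectrum_of_bound [CompleteSpace H] {T : H →L[ℂ] H} (hT : IsSelfAdjoint T) {E r : ℝ}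
    (hr : 0 < r) (h : ∀ f, r * ‖f‖ ≤ ‖T f - (E : ℂ) • f‖) : (E : ℂ) ∉ spectrum ℂ T := by
  rw [spectrum.mem_iff, not_not]
  set S : H →L[ℂ] H := algebraMap ℂ (H →L[ℂ] H) E - T with hS
  have hSf : ∀ f, S f = (E : ℂ) • f - T f := fun f => by
    simp [hS, Algebra.algebraMap_eq_smul_one]
  have hSsa : IsSelfAdjoint S := by
    refine IsSelfAdjoint.sub ?_ hT
    rw [Algebra.algebraMap_eq_smul_one]
    refine IsSelfAdjoint.smul ?_ (IsSelfAdjoint.one _)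
    simp [isSelfAdjoint_iff]
  rw [ContinuousLinearMap.isUnit_iff_bijective,
    ContinuousLinearMap.bijective_iff_dense_range_and_antilipschitz]
  have hb : ∀ f, r * ‖f‖ ≤ ‖S f‖ := fun f => by rw [hSf, norm_sub_rev]; exact h f
  refine ⟨?_, ⟨⟨r⁻¹, by positivity⟩, ?_⟩⟩
  · rw [Submodule.topologicalClosure_eq_top_iff, Submodule.eq_bot_iff]
    intro g hg
    have h1 : S g = 0 := by
      rw [← inner_self_eq_zero (𝕜 := ℂ), ← ContinuousLinearMap.adjoint_inner_left,
        hSsa.adjoint_eq]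
      exact (Submodule.mem_orthogonal _ _).1 hg (S (S g)) ⟨S g, rfl⟩
    have h3 := hb g
    rw [h1, norm_zero] at h3
    have : ‖g‖ ≤ 0 := by
      by_contra hc
      push Not at hc
      nlinarith [mul_pos hr hc]
    simpa using this
  · refine ContinuousLinearMap.antilipschitz_of_bound _ fun f => ?_
    change ‖f‖ ≤ r⁻¹ * ‖S f‖
    rw [inv_mul_eq_div, le_div_iff₀ hr, mul_comm]
    exact hb f

lemma exists_bound_of_notMem_spectrum {T : H →L[ℂ] H} {E : ℂ} (h : E ∉ spectrum ℂ T) :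
    ∃ r : ℝ, 0 < r ∧ ∀ f, r * ‖f‖ ≤ ‖T f - E • f‖ := by
  rw [spectrum.mem_iff, not_not] at h
  obtain ⟨u, hu⟩ := h
  refine ⟨(‖(↑u⁻¹ : H →L[ℂ] H)‖ + 1)⁻¹, by positivity, fun f => ?_⟩
  have h1 : (↑u⁻¹ : H →L[ℂ] H) ((↑u : H →L[ℂ] H) f) = f := by
    rw [← mul_apply_eq_comp, Units.inv_mul, one_apply_eq_self]
  have h2 : (↑u : H →L[ℂ] H) f = E • f - T f := by
    rw [hu]; simp [Algebra.algebraMap_eq_smul_one]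
  rw [inv_mul_le_iff₀ (by positivity)]
  calc ‖f‖ = ‖(↑u⁻¹ : H →L[ℂ] H) ((↑u : H →L[ℂ] H) f)‖ := by rw [h1]
    _ ≤ ‖(↑u⁻¹ : H →L[ℂ] H)‖ * ‖(↑u : H →L[ℂ] H) f‖ := ContinuousLinearMap.le_opNorm _ _
    _ ≤ (‖(↑u⁻¹ : H →L[ℂ] H)‖ + 1) * ‖T f - E • f‖ := by
        rw [h2, norm_sub_rev]; gcongr; linarith

lemma inner_self_eq_ofReal_norm_sq (x : H) : inner ℂ x x = ((‖x‖ ^ 2 : ℝ) : ℂ) := by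
  rw [inner_self_eq_norm_sq_to_K]
  norm_cast

/-- `μ` is not an eigenvalue of `T`. -/
def NoEigen (T : H →L[ℂ] H) (μ : ℝ) : Prop := ∀ x, T x = (μ : ℂ) • x → x = 0

lemma noEigen_of_bound {T : H →L[ℂ] H} {c r μ : ℝ}
    (h : ∀ x, r * ‖x‖ ≤ ‖T x - (c : ℂ) • x‖) (hμ : |μ - c| < r) : NoEigen T μ := by
  intro x hx
  have h1 := h x
  rw [hx, ← sub_smul, norm_smul, ← Complex.ofReal_sub, Complex.norm_real, Real.norm_eq_abs] at h1
  by_contra hc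
  have : 0 < ‖x‖ := norm_pos_iff.2 hc
  nlinarith

section FiniteDimensional

variable [FiniteDimensional ℂ H]

/-- In an orthonormal eigenbasis `T - c` multiplies each coordinate by a number of modulus at least
`r`. With `noEigen_of_bound` this trades the absence of eigenvalues for inequalities that behave
well under perturbation. -/
lemma bound_of_noEigen {T : H →L[ℂ] H} (hT : (T : H →ₗ[ℂ] H).IsSymmetric) {c r : ℝ} (hr : 0 ≤ r)
    (h : ∀ μ, |μ - c| < r → NoEigen T μ) (x : H) : r * ‖x‖ ≤ ‖T x - (c : ℂ) • x‖ := by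
  set b := hT.eigenvectorBasis rfl
  have hev : ∀ i, r ≤ |hT.eigenvalues rfl i - c| := by
    intro i
    by_contra hc
    push Not at hc
    have h1 := h _ hc (b i) (hT.apply_eigenvectorBasis rfl i)
    have h2 := b.orthonormal.1 i
    rw [h1, norm_zero] at h2
    exact zero_ne_one h2
  refine (sq_le_sq₀ (by positivity) (norm_nonneg _)).1 ?_
  rw [mul_pow, ← b.sum_sq_norm_inner_right x, ← b.sum_sq_norm_inner_right (T x - (c : ℂ) • x),
    Finset.mul_sum]
  refine Finset.sum_le_sum fun i _ => ?_
  have h1 : inner ℂ (b i) (T x) = (hT.eigenvalues rfl i : ℂ) * inner ℂ (b i) x := by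
    have h2 := hT (b i) x
    have h3 : (T : H →ₗ[ℂ] H) (b i) = _ := hT.apply_eigenvectorBasis rfl i
    rw [h3, inner_smul_left] at h2
    simpa using h2.symm
  rw [inner_sub_right, inner_smul_right, h1, ← sub_mul, norm_mul, mul_pow, ← Complex.ofReal_sub,
    Complex.norm_real, Real.norm_eq_abs]
  gcongr
  exact hev i

/-- Along a continuous family of symmetric operators, eigenvalues do not enter an interval through
ends that they avoid. -/
lemma noEigen_Ioo_of_continuous {K : ℝ → H →L[ℂ] H} (hK : Continuous K)
    (hs : ∀ κ, (K κ : H →ₗ[ℂ] H).IsSymmetric) {E₁ E₂ δ : ℝ} (hE : E₁ < E₂) (hδ : 0 < δ)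
    (h₁ : ∀ κ μ, |μ - E₁| < δ → NoEigen (K κ) μ) (h₂ : ∀ κ μ, |μ - E₂| < δ → NoEigen (K κ) μ)
    {κ₀ : ℝ} (h₀ : ∀ μ ∈ Ioo E₁ E₂, NoEigen (K κ₀) μ) (κ : ℝ) :
    ∀ μ ∈ Ioo E₁ E₂, NoEigen (K κ) μ := by
  -- With `c` the midpoint and `r` the half-length, having no eigenvalue in the interval is the
  -- bound `r‖x‖ ≤ ‖(K κ - c) x‖`, a closed condition on `κ`. It is also open: the margins `δ` at
  -- the ends improve `r` to `r + δ`, which absorbs a change of `K` of norm below `δ`. Connectedness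
  -- of `ℝ` finishes.
  set c := (E₁ + E₂) / 2 with hc
  set r := (E₂ - E₁) / 2 with hr
  have hr0 : 0 < r := by simp only [hr]; linarith
  have key : ∀ κ, (∀ μ ∈ Ioo E₁ E₂, NoEigen (K κ) μ) ↔
      ∀ x, r * ‖x‖ ≤ ‖K κ x - (c : ℂ) • x‖ := by
    refine fun κ => ⟨fun h x => bound_of_noEigen (hs κ) hr0.le (fun μ hμ => h μ ?_) x,
      fun h μ hμ => noEigen_of_bound h ?_⟩
    · rw [abs_lt] at hμ
      exact ⟨by linarith [hμ.1], by linarith [hμ.2]⟩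
    · rw [abs_lt]
      exact ⟨by linarith [hμ.1], by linarith [hμ.2]⟩
  set U := {κ | ∀ μ ∈ Ioo E₁ E₂, NoEigen (K κ) μ} with hU
  have hclosed : IsClosed U := by
    have : U = ⋂ x, {κ | r * ‖x‖ ≤ ‖K κ x - (c : ℂ) • x‖} := by
      ext κ
      simp only [mem_iInter]
      exact key κ
    rw [this]
    exact isClosed_iInter fun x => isClosed_le continuous_const (by fun_prop)
  have hopen : IsOpen U := by
    rw [Metric.isOpen_iff]
    intro κ hκ
    have hb : ∀ x, (r + δ) * ‖x‖ ≤ ‖K κ x - (c : ℂ) • x‖ := by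
      refine bound_of_noEigen (hs κ) (by linarith) fun μ hμ => ?_
      rw [abs_lt] at hμ
      rcases le_or_gt μ E₁ with h | h
      · exact h₁ κ μ (by rw [abs_lt]; constructor <;> linarith [hμ.1])
      rcases lt_or_ge μ E₂ with h' | h'
      · exact hκ μ ⟨h, h'⟩
      · exact h₂ κ μ (by rw [abs_lt]; constructor <;> linarith [hμ.2])
    obtain ⟨ρ, hρ, hρ'⟩ := Metric.continuous_iff.1 hK κ δ hδ
    refine ⟨ρ, hρ, fun κ' hκ' => (key κ').2 fun x => ?_⟩
    have h3 := hρ' κ' hκ'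
    rw [dist_eq_norm] at h3
    have h4 : ‖K κ x - (c : ℂ) • x‖ ≤ ‖K κ' x - (c : ℂ) • x‖ + δ * ‖x‖ := by
      have : K κ x - (c : ℂ) • x = (K κ' x - (c : ℂ) • x) - (K κ' - K κ) x := by
        simp only [sub_apply]; abel
      rw [this]
      refine (norm_sub_le _ _).trans (add_le_add_right ?_ _)
      exact ((K κ' - K κ).le_opNorm x).trans (by gcongr)
    nlinarith [hb x]
  have huniv : U = univ := IsClopen.eq_univ ⟨hclosed, hopen⟩ ⟨κ₀, h₀⟩
  have : κ ∈ U := huniv ▸ mem_univ κ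
  exact this

end FiniteDimensional

/-- If the quadratic form of `T` is at least `E` on the common kernel of `ι`-many functionals, then
`T` has at most `card ι` eigenvalues below `E`. -/
lemma card_eigenvalues_le {ι : Type*} [Fintype ι] {T : H →L[ℂ] H}
    (hT : (T : H →ₗ[ℂ] H).IsSymmetric) (φ : ι → H →ₗ[ℂ] ℂ) {E : ℝ}
    (hφ : ∀ x, (∀ i, φ i x = 0) → E * ‖x‖ ^ 2 ≤ (inner ℂ x (T x)).re)
    (s : Finset ℝ) (hs : ∀ μ ∈ s, μ < E ∧ ¬ NoEigen T μ) : s.card ≤ Fintype.card ι := by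
  have hw : ∀ μ : s, ∃ x : H, T x = ((μ : ℝ) : ℂ) • x ∧ x ≠ 0 := by
    intro μ
    have := (hs μ μ.2).2
    simp only [NoEigen, not_forall] at this
    obtain ⟨x, hx, hx'⟩ := this
    exact ⟨x, hx, hx'⟩
  choose w hw hw0 using hw
  by_contra hc
  push Not at hc
  have horth : ∀ μ ν : s, μ ≠ ν → inner ℂ (w μ) (w ν) = 0 := by
    intro μ ν hμν
    have h1 := hT (w μ) (w ν)
    change inner ℂ (T (w μ)) (w ν) = inner ℂ (w μ) (T (w ν)) at h1
    rw [hw, hw, inner_smul_left, inner_smul_right, Complex.conj_ofReal, ← sub_eq_zero,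
      ← sub_mul, mul_eq_zero] at h1
    rcases h1 with h1 | h1
    · exfalso
      rw [← Complex.ofReal_sub, Complex.ofReal_eq_zero, sub_eq_zero] at h1
      exact hμν (Subtype.ext h1)
    · exact h1
  -- With more eigenvectors than functionals, some nontrivial combination of eigenvectors is killed
  -- by every `φ i`; its quadratic form is below `E‖x‖²` since all the eigenvalues are.
  let Φ : (s → ℂ) →ₗ[ℂ] (ι → ℂ) :=
    LinearMap.pi fun i => ∑ μ : s, (φ i (w μ)) • LinearMap.proj μ
  have hker : LinearMap.ker Φ ≠ ⊥ := by
    apply LinearMap.ker_ne_bot_of_finrank_lt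
    simpa using hc
  obtain ⟨a, ha, ha0⟩ := Submodule.exists_mem_ne_zero_of_ne_bot hker
  set x := ∑ μ : s, a μ • w μ with hx
  have hx0 : ∀ i, φ i x = 0 := by
    intro i
    have : Φ a i = 0 := by rw [LinearMap.mem_ker.1 ha]; rfl
    rw [hx, map_sum, ← this]
    simp [Φ, mul_comm]
  have hin : ∀ c : s → ℂ, inner ℂ x (∑ μ : s, c μ • w μ)
      = ∑ μ : s, (starRingEnd ℂ (a μ) * c μ) * (‖w μ‖ ^ 2 : ℝ) := by
    intro c
    rw [hx, sum_inner]
    refine Finset.sum_congr rfl fun μ _ => ?_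
    rw [inner_sum, Finset.sum_eq_single μ]
    · rw [inner_smul_left, inner_smul_right, inner_self_eq_ofReal_norm_sq, mul_assoc]
    · intro ν _ hν
      rw [inner_smul_left, inner_smul_right, horth μ ν (Ne.symm hν)]
      simp
    · simp
  have hTx : T x = ∑ μ : s, (((μ : ℝ) : ℂ) * a μ) • w μ := by
    rw [hx, map_sum]
    refine Finset.sum_congr rfl fun μ _ => ?_
    rw [map_smul, hw, smul_smul, mul_comm]
  have h1 : ‖x‖ ^ 2 = ∑ μ : s, ‖a μ‖ ^ 2 * ‖w μ‖ ^ 2 := by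
    have h2 := hin a
    rw [← hx, inner_self_eq_ofReal_norm_sq] at h2
    have h3 : ((‖x‖ ^ 2 : ℝ) : ℂ) = ((∑ μ : s, ‖a μ‖ ^ 2 * ‖w μ‖ ^ 2 : ℝ) : ℂ) := by
      rw [Complex.ofReal_sum]
      refine Eq.trans h2 (Finset.sum_congr rfl fun μ _ => ?_)
      rw [Complex.conj_mul']
      push_cast
      ring
    exact_mod_cast h3
  have h2 : (inner ℂ x (T x)).re = ∑ μ : s, (μ : ℝ) * (‖a μ‖ ^ 2 * ‖w μ‖ ^ 2) := by
    rw [hTx, hin, Complex.re_sum]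
    refine Finset.sum_congr rfl fun μ _ => ?_
    rw [show starRingEnd ℂ (a μ) * (((μ : ℝ) : ℂ) * a μ) * ((‖w μ‖ ^ 2 : ℝ) : ℂ)
      = ((((μ : ℝ) * (‖a μ‖ ^ 2 * ‖w μ‖ ^ 2)) : ℝ) : ℂ) by
        rw [mul_left_comm, Complex.conj_mul']; push_cast; ring]
    exact Complex.ofReal_re _
  have h3 := hφ x hx0
  rw [h1, h2, Finset.mul_sum] at h3
  refine absurd h3 (not_le.2 (Finset.sum_lt_sum (fun μ _ => ?_) ?_))
  · have := (hs μ μ.2).1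
    gcongr
  · obtain ⟨μ, hμ⟩ := Function.ne_iff.1 ha0
    refine ⟨μ, Finset.mem_univ _, ?_⟩
    have := (hs μ μ.2).1
    have h4 : 0 < ‖a μ‖ ^ 2 * ‖w μ‖ ^ 2 := by
      have : a μ ≠ 0 := hμ
      have := norm_pos_iff.2 this
      have := norm_pos_iff.2 (hw0 μ)
      positivity
    gcongr

end Abstract

end Nanotube

end

/-! ### Tube operators and bounded generalized eigenfunctions. -/

noncomputable section

namespace Nanotube

variable {N : ℕ}

/-- The action on functions of a tube Hamiltonian whose bonds join `(n, 0, k)` to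
`(n, 1, k) + t i`, with potential `V₀` on the atoms of type `0` and `V₁` on those of type `1`. -/
def tubeFun (t : Fin 3 → ℤ × ZMod N) (V₀ V₁ : ℤ → ℝ) (f : Vertex N → ℂ) : Vertex N → ℂ :=
  fun ω => if ω.2.1 = 0 then
      ∑ i, f (ω.1 + (t i).1, 1, ω.2.2 + (t i).2) + V₀ ω.1 * f (ω.1, 0, ω.2.2)
    else ∑ i, f (ω.1 - (t i).1, 0, ω.2.2 - (t i).2) + V₁ ω.1 * f (ω.1, 1, ω.2.2)

lemma tubeFun_zero (t : Fin 3 → ℤ × ZMod N) (V₀ V₁ : ℤ → ℝ) (f : Vertex N → ℂ) (n : ℤ)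
    (k : ZMod N) : tubeFun t V₀ V₁ f (n, 0, k) =
      ∑ i, f (n + (t i).1, 1, k + (t i).2) + V₀ n * f (n, 0, k) := by
  simp [tubeFun]

lemma tubeFun_one (t : Fin 3 → ℤ × ZMod N) (V₀ V₁ : ℤ → ℝ) (f : Vertex N → ℂ) (n : ℤ)
    (k : ZMod N) : tubeFun t V₀ V₁ f (n, 1, k) =
      ∑ i, f (n - (t i).1, 0, k - (t i).2) + V₁ n * f (n, 1, k) := by
  simp [tubeFun]

/-- `T` is the self-adjoint operator on `ℓ²` given by `tubeFun`. -/
structure IsTube (t : Fin 3 → ℤ × ZMod N) (V₀ V₁ : ℤ → ℝ)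
    (T : L2 (Vertex N) →L[ℂ] L2 (Vertex N)) : Prop where
  selfAdjoint : IsSelfAdjoint T
  apply_eq : ∀ f ω, T f ω = tubeFun t V₀ V₁ f ω

lemma L2_norm_le_of_le {ι : Type} {f g : L2 ι} {c : ℝ} (hc : 0 ≤ c)
    (h : ∀ i, ‖f i‖ ≤ c * ‖g i‖) : ‖f‖ ≤ c * ‖g‖ := by
  refine (sq_le_sq₀ (norm_nonneg _) (by positivity)).1 ?_
  rw [norm_sq_eq_tsum, mul_pow, norm_sq_eq_tsum g, ← tsum_mul_left]
  refine (summable_norm_sq f).tsum_le_tsum (fun i => ?_) ((summable_norm_sq g).mul_left _)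
  rw [← mul_pow]
  exact pow_le_pow_left₀ (norm_nonneg _) (h i) 2

lemma summable_exp_neg_abs {s : ℝ} (hs : 0 < s) :
    Summable fun n : ℤ => Real.exp (-s * |(n : ℝ)|) := by
  have h : Summable fun n : ℕ => Real.exp (-s * n) := by
    have := Real.summable_exp_nat_mul_iff.2 (show -s < 0 by linarith)
    simpa [mul_comm] using this
  refine Summable.of_nat_of_neg ?_ ?_ <;> simpa using h

lemma abs_exp_sub_exp_le {s : ℝ} (hs : 0 < s) {n d : ℤ} (hd : |d| ≤ 1) :
    |Real.exp (-s * |((n + d : ℤ) : ℝ)|) - Real.exp (-s * |(n : ℝ)|)|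
      ≤ (Real.exp s - 1) * Real.exp (-s * |((n + d : ℤ) : ℝ)|) := by
  have hd' : |(d : ℝ)| ≤ 1 := by exact_mod_cast hd
  set a := |((n + d : ℤ) : ℝ)| with ha
  set b := |(n : ℝ)| with hb
  have h1 : a ≤ b + 1 := by
    have := abs_add_le (n : ℝ) d
    simp only [ha, Int.cast_add]; linarith
  have h2 : b ≤ a + 1 := by
    have := abs_sub ((n : ℝ) + d) d
    simp only [add_sub_cancel_right] at this
    simp only [ha, Int.cast_add]; linarith
  have h3 : Real.exp (-s * b) ≤ Real.exp s * Real.exp (-s * a) := by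
    rw [← Real.exp_add, Real.exp_le_exp]; nlinarith
  have h4 : Real.exp (-s * a) ≤ Real.exp s * Real.exp (-s * b) := by
    rw [← Real.exp_add, Real.exp_le_exp]; nlinarith
  have h5 : 1 ≤ Real.exp s := Real.one_le_exp hs.le
  have h6 := Real.exp_pos (-s * a)
  have h7 := Real.exp_pos (-s * b)
  rw [abs_le]
  constructor
  · linarith
  · nlinarith

/-- A bounded generalized eigenfunction forces its energy into the spectrum. -/
lemma mem_realSpectrum_of_bounded [NeZero N] {t : Fin 3 → ℤ × ZMod N} (ht : ∀ i, |(t i).1| ≤ 1)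
    {V₀ V₁ : ℤ → ℝ} {T T₀ : L2 (Vertex N) →L[ℂ] L2 (Vertex N)} (hT : IsTube t V₀ V₁ T)
    (hT₀ : IsTube t 0 0 T₀) {f : Vertex N → ℂ} {C : ℝ} (hC : ∀ ω, ‖f ω‖ ≤ C) (hf : f ≠ 0) {E : ℝ}
    (hE : ∀ ω, tubeFun t V₀ V₁ f ω = E * f ω) : E ∈ realSpectrum T := by
  by_contra hc
  obtain ⟨r, hr, hb⟩ := exists_bound_of_notMem_spectrum hc
  obtain ⟨s, hs, hs'⟩ : ∃ s : ℝ, 0 < s ∧ (Real.exp s - 1) * ‖T₀‖ < r := by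
    have h1 : Tendsto (fun s : ℝ => (Real.exp s - 1) * ‖T₀‖) (𝓝[>] 0)
        (𝓝 ((Real.exp 0 - 1) * ‖T₀‖)) :=
      ((by fun_prop : Continuous fun s : ℝ => (Real.exp s - 1) * ‖T₀‖).tendsto 0).mono_left
        nhdsWithin_le_nhds
    rw [Real.exp_zero, sub_self, zero_mul] at h1
    obtain ⟨s, h2, h3⟩ := ((h1.eventually (gt_mem_nhds hr)).and self_mem_nhdsWithin).exists
    exact ⟨s, h3, h2⟩
  -- An exponential cutoff makes `f` square summable, and `w` varies by a relative amount of at most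
  -- `exp s - 1` per axial step. So `w f` is an approximate eigenfunction, with error below the
  -- resolvent bound `r`.
  set w : ℤ → ℝ := fun n => Real.exp (-s * |(n : ℝ)|) with hw
  have hwpos : ∀ n, 0 < w n := fun n => Real.exp_pos _
  have hsum : Summable fun ω : Vertex N => ‖(w ω.1 : ℂ) * f ω‖ ^ 2 := by
    have h1 : Summable fun ω : Vertex N => w ω.1 * C ^ 2 := by
      refine Summable.mul_right _ ?_
      have h2 := (summable_exp_neg_abs hs).mul_of_nonneg
        (Summable.of_finite (f := fun _ : Fin 2 × ZMod N => (1 : ℝ)))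
        (fun n => (hwpos n).le) (fun _ => zero_le_one)
      simpa [hw] using h2
    refine Summable.of_nonneg_of_le (fun _ => by positivity) (fun ω => ?_) h1
    rw [norm_mul, Complex.norm_real, Real.norm_eq_abs, abs_of_pos (hwpos _), mul_pow]
    have h3 : w ω.1 ≤ 1 := by
      simp only [hw]; rw [Real.exp_le_one_iff]
      nlinarith [abs_nonneg (ω.1 : ℝ)]
    have h4 : w ω.1 ^ 2 ≤ w ω.1 := by nlinarith [hwpos ω.1]
    have h5 : ‖f ω‖ ^ 2 ≤ C ^ 2 := pow_le_pow_left₀ (norm_nonneg _) (hC ω) 2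
    have := (hwpos ω.1).le
    gcongr
  set g : L2 (Vertex N) := ⟨fun ω => (w ω.1 : ℂ) * f ω, memlp_of_summable hsum⟩ with hg
  have hgω : ∀ ω, g ω = (w ω.1 : ℂ) * f ω := fun _ => rfl
  -- The modulus of `g` serves as a majorant: all hopping coefficients are positive, so the error
  -- `(T - E) g` is pointwise at most `(exp s - 1) T₀ |g|`, whose norm is controlled by `‖T₀‖`.
  set h : L2 (Vertex N) := ⟨fun ω => (‖g ω‖ : ℂ), memlp_of_summable (by
    simpa using summable_norm_sq g)⟩ with hh
  have hhω : ∀ ω, h ω = (‖g ω‖ : ℂ) := fun _ => rfl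
  have hnorm : ‖h‖ = ‖g‖ := by
    have : ‖h‖ ^ 2 = ‖g‖ ^ 2 := by simp [norm_sq_eq_tsum, hhω]
    exact (sq_eq_sq₀ (norm_nonneg _) (norm_nonneg _)).1 this
  have hcomb : ∀ (n : ℤ) (d : Fin 3 → ℤ) (z : Fin 3 → Fin 2 × ZMod N), (∀ i, |d i| ≤ 1) →
      ‖∑ i, (w (n + d i) : ℂ) * f (n + d i, z i) - w n * ∑ i, f (n + d i, z i)‖
        ≤ (Real.exp s - 1) * ‖∑ i, h (n + d i, z i)‖ := by
    intro n d z hd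
    rw [Finset.mul_sum, ← Finset.sum_sub_distrib]
    have h1 : ‖∑ i, h (n + d i, z i)‖ = ∑ i, ‖g (n + d i, z i)‖ := by
      simp only [hhω]
      rw [← Complex.ofReal_sum, Complex.norm_real, Real.norm_eq_abs,
        abs_of_nonneg (Finset.sum_nonneg fun i _ => norm_nonneg _)]
    rw [h1, Finset.mul_sum]
    refine norm_sum_le_of_le _ fun i _ => ?_
    rw [← sub_mul, norm_mul, hgω, norm_mul, ← Complex.ofReal_sub, Complex.norm_real,
      Complex.norm_real, Real.norm_eq_abs, Real.norm_eq_abs, abs_of_pos (hwpos _), ← mul_assoc]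
    exact mul_le_mul_of_nonneg_right (abs_exp_sub_exp_le hs (hd i)) (norm_nonneg _)
  have hpt : ∀ ω, ‖(T g - (E : ℂ) • g) ω‖ ≤ (Real.exp s - 1) * ‖T₀ h ω‖ := by
    rintro ⟨n, j, k⟩
    have e1 : (T g - (E : ℂ) • g) (n, j, k) = T g (n, j, k) - E * g (n, j, k) := rfl
    rw [e1, hT.apply_eq, hT₀.apply_eq, hgω, mul_left_comm, ← hE]
    fin_cases j
    · simp only [Fin.zero_eta, tubeFun_zero, Pi.zero_apply, Complex.ofReal_zero, zero_mul,
        add_zero, hgω]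
      convert hcomb n (fun i => (t i).1) (fun i => (1, k + (t i).2)) ht using 2
      ring
    · simp only [Fin.mk_one, tubeFun_one, Pi.zero_apply, Complex.ofReal_zero, zero_mul,
        add_zero, hgω, sub_eq_add_neg]
      convert hcomb n (fun i => -(t i).1) (fun i => (0, k + -(t i).2))
        (by simpa using ht) using 2 <;> ring
  have h1 := L2_norm_le_of_le (by linarith [Real.add_one_le_exp s]) hpt
  have h2 := hb g
  have h3 : 0 < ‖g‖ := by
    rw [norm_pos_iff]
    intro h0
    apply hf
    funext ω
    have h4 := hgω ω
    rw [h0] at h4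
    have h5 : (w ω.1 : ℂ) ≠ 0 := by exact_mod_cast (hwpos _).ne'
    simpa [h5] using h4.symm
  have h4 := T₀.le_opNorm h
  rw [hnorm] at h4
  have h5 : 0 ≤ Real.exp s - 1 := by linarith [Real.add_one_le_exp s]
  nlinarith [mul_le_mul_of_nonneg_left h4 h5]

end Nanotube

end

/-! ### Bloch Hamiltonians on the discrete torus. -/

noncomputable section

namespace Nanotube

section Block

variable {F : Type*} [NormedAddCommGroup F] [InnerProductSpace ℂ F] [FiniteDimensional ℂ F]

/-- The block operator `(x, y) ↦ (A y + V x, B x + W y)`. -/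
def block (A B V W : F →L[ℂ] F) : WithLp 2 (F × F) →L[ℂ] WithLp 2 (F × F) :=
  LinearMap.toContinuousLinearMap
    { toFun := fun x => WithLp.toLp 2 (A x.snd + V x.fst, B x.fst + W x.snd)
      map_add' := fun x y => by
        refine WithLp.ofLp_injective 2 (Prod.ext ?_ ?_)
        · change A (x.snd + y.snd) + V (x.fst + y.fst)
            = (A x.snd + V x.fst) + (A y.snd + V y.fst)
          rw [map_add, map_add]; abel
        · change B (x.fst + y.fst) + W (x.snd + y.snd)
            = (B x.fst + W x.snd) + (B y.fst + W y.snd)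
          rw [map_add, map_add]; abel
      map_smul' := fun c x => by
        refine WithLp.ofLp_injective 2 (Prod.ext ?_ ?_)
        · change A (c • x.snd) + V (c • x.fst) = c • (A x.snd + V x.fst)
          rw [map_smul, map_smul, smul_add]
        · change B (c • x.fst) + W (c • x.snd) = c • (B x.fst + W x.snd)
          rw [map_smul, map_smul, smul_add] }

@[simp] lemma block_fst (A B V W : F →L[ℂ] F) (x : WithLp 2 (F × F)) :
    (block A B V W x).fst = A x.snd + V x.fst := rfl

@[simp] lemma block_snd (A B V W : F →L[ℂ] F) (x : WithLp 2 (F × F)) :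
    (block A B V W x).snd = B x.fst + W x.snd := rfl

lemma isSymmetric_block {A B V W : F →L[ℂ] F} (hAB : ∀ x y, inner ℂ (A x) y = inner ℂ x (B y))
    (hV : ∀ x y, inner ℂ (V x) y = inner ℂ x (V y))
    (hW : ∀ x y, inner ℂ (W x) y = inner ℂ x (W y)) :
    (block A B V W : WithLp 2 (F × F) →ₗ[ℂ] WithLp 2 (F × F)).IsSymmetric := by
  have hBA : ∀ x y, inner ℂ (B x) y = inner ℂ x (A y) := fun x y => by
    rw [← inner_conj_symm, ← hAB, inner_conj_symm]
  intro x y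
  simp only [ContinuousLinearMap.coe_coe, WithLp.prod_inner_apply]
  change inner ℂ (block A B V W x).fst y.fst + inner ℂ (block A B V W x).snd y.snd
    = inner ℂ x.fst (block A B V W y).fst + inner ℂ x.snd (block A B V W y).snd
  simp only [block_fst, block_snd, inner_add_left, inner_add_right, hAB, hBA, hV, hW]
  ring

lemma continuous_block {Y : Type*} [TopologicalSpace Y] {A B : Y → F →L[ℂ] F} (hA : Continuous A)
    (hB : Continuous B) (V W : F →L[ℂ] F) : Continuous fun y => block (A y) (B y) V W := by
  rw [continuous_clm_apply]
  intro x
  refine (WithLp.prod_continuous_toLp 2 F F).comp ?_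
  exact ((hA.clm_apply continuous_const).add continuous_const).prodMk
    ((hB.clm_apply continuous_const).add continuous_const)

end Block

variable {p N : ℕ}

/-- The position on the torus of a displacement on the tube. -/
def proj (a : ℤ × ZMod N) : ZMod p × ZMod N := ((a.1 : ZMod p), a.2)

lemma proj_neg (a : ℤ × ZMod N) : (proj (-a) : ZMod p × ZMod N) = -proj a := by
  simp [proj]

variable (p N) [NeZero p] [NeZero N]

/-- Functions on the discrete torus. -/
abbrev Fiber : Type := EuclideanSpace ℂ (ZMod p × ZMod N)

variable {p N}

/-- Translation by `a` on the torus. -/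
def shift (a : ZMod p × ZMod N) : Fiber p N →L[ℂ] Fiber p N :=
  (LinearIsometryEquiv.piLpCongrLeft 2 ℂ ℂ (Equiv.subRight a)).toContinuousLinearEquiv

@[simp] lemma shift_apply (a : ZMod p × ZMod N) (g : Fiber p N) (x : ZMod p × ZMod N) :
    shift a g x = g (x + a) := rfl

@[simp] lemma norm_shift (a : ZMod p × ZMod N) (g : Fiber p N) : ‖shift a g‖ = ‖g‖ :=
  (LinearIsometryEquiv.piLpCongrLeft 2 ℂ ℂ (Equiv.subRight a)).norm_map g

lemma shift_shift (a b : ZMod p × ZMod N) (g : Fiber p N) :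
    shift a (shift b g) = shift (a + b) g := by
  ext x; simp [add_assoc]

lemma inner_shift (a : ZMod p × ZMod N) (g h : Fiber p N) :
    inner ℂ (shift a g) h = inner ℂ g (shift (-a) h) := by
  simp only [PiLp.inner_apply, shift_apply]
  exact Fintype.sum_equiv (Equiv.addRight a) _ _ (fun x => by simp)

/-- Multiplication by a sequence. -/
def pot (V : ℤ → ℝ) : Fiber p N →L[ℂ] Fiber p N :=
  LinearMap.toContinuousLinearMap
    { toFun := fun g => WithLp.toLp 2 fun x => (V x.1.val : ℂ) * g x
      map_add' := fun g h => by ext x; simp [mul_add]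
      map_smul' := fun c g => by ext x; simp [mul_left_comm] }

@[simp] lemma pot_apply (V : ℤ → ℝ) (g : Fiber p N) (x : ZMod p × ZMod N) :
    pot V g x = (V x.1.val : ℂ) * g x := rfl

lemma inner_pot (V : ℤ → ℝ) (g h : Fiber p N) : inner ℂ (pot V g) h = inner ℂ g (pot V h) := by
  simp only [PiLp.inner_apply, pot_apply]
  refine Finset.sum_congr rfl fun x _ => ?_
  simp [mul_left_comm, mul_assoc]

/-- The twisted hopping operator at quasimomentum `κ`. -/
def hop (t : Fin 3 → ℤ × ZMod N) (κ : ℝ) : Fiber p N →L[ℂ] Fiber p N :=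
  ∑ i, Complex.exp (κ * (t i).1 * Complex.I) • shift (proj (t i))

lemma hop_apply (t : Fin 3 → ℤ × ZMod N) (κ : ℝ) (g : Fiber p N) (x : ZMod p × ZMod N) :
    hop t κ g x = ∑ i, Complex.exp (κ * (t i).1 * Complex.I) * g (x + proj (t i)) := by
  simp [hop, Fin.sum_univ_three]

lemma continuous_hop (t : Fin 3 → ℤ × ZMod N) :
    Continuous (hop t : ℝ → Fiber p N →L[ℂ] Fiber p N) := by
  unfold hop
  fun_prop

lemma inner_hop (t : Fin 3 → ℤ × ZMod N) (κ : ℝ) (g h : Fiber p N) :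
    inner ℂ (hop t κ g) h = inner ℂ g (hop (-t) κ h) := by
  simp only [hop, FunLike.coe_sum, Finset.sum_apply, sum_inner, inner_sum]
  refine Finset.sum_congr rfl fun i _ => ?_
  simp only [FunLike.coe_smul, Pi.smul_apply, inner_smul_left, inner_smul_right, inner_shift,
    Pi.neg_apply, proj_neg, ← Complex.exp_conj]
  congr 2
  simp

/-- The Hamiltonian at quasimomentum `κ`. -/
def bloch (t : Fin 3 → ℤ × ZMod N) (V₀ V₁ : ℤ → ℝ) (κ : ℝ) :
    WithLp 2 (Fiber p N × Fiber p N) →L[ℂ] WithLp 2 (Fiber p N × Fiber p N) :=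
  block (hop t κ) (hop (-t) κ) (pot V₀) (pot V₁)

lemma isSymmetric_bloch (t : Fin 3 → ℤ × ZMod N) (V₀ V₁ : ℤ → ℝ) (κ : ℝ) :
    ((bloch t V₀ V₁ κ : WithLp 2 (Fiber p N × Fiber p N) →L[ℂ] _) :
      WithLp 2 (Fiber p N × Fiber p N) →ₗ[ℂ] _).IsSymmetric :=
  isSymmetric_block (inner_hop t κ) (inner_pot V₀) (inner_pot V₁)

lemma continuous_bloch (t : Fin 3 → ℤ × ZMod N) (V₀ V₁ : ℤ → ℝ) :
    Continuous (bloch t V₀ V₁ :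
      ℝ → WithLp 2 (Fiber p N × Fiber p N) →L[ℂ] WithLp 2 (Fiber p N × Fiber p N)) :=
  continuous_block (continuous_hop t) (continuous_hop (-t)) _ _

/-- The quasiperiodic function on the tube given by `x` at quasimomentum `κ`. -/
def unfold (κ : ℝ) (x : WithLp 2 (Fiber p N × Fiber p N)) : Vertex N → ℂ := fun ω =>
  Complex.exp (κ * ω.1 * Complex.I) *
    (if ω.2.1 = 0 then x.fst ((ω.1 : ZMod p), ω.2.2) else x.snd ((ω.1 : ZMod p), ω.2.2))

/-- `pot` samples a sequence at the representatives in `[0, p)`; for a `p`-periodic sequence nothing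
is lost. -/
lemma periodic_val {V : ℤ → ℝ} (hV : ∀ n, V (n + p) = V n) (n : ℤ) :
    V ((n : ZMod p).val : ℤ) = V n := by
  have hp : Function.Periodic V (p : ℤ) := hV
  rw [ZMod.val_intCast]
  conv_rhs => rw [← Int.emod_add_mul_ediv n p]
  rw [mul_comm]
  exact ((hp.int_mul (n / p)) (n % p)).symm

lemma tubeFun_unfold (t : Fin 3 → ℤ × ZMod N) {V₀ V₁ : ℤ → ℝ} (hV₀ : ∀ n, V₀ (n + p) = V₀ n)
    (hV₁ : ∀ n, V₁ (n + p) = V₁ n) (κ : ℝ) (x : WithLp 2 (Fiber p N × Fiber p N)) :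
    tubeFun t V₀ V₁ (unfold κ x) = unfold κ (bloch t V₀ V₁ κ x) := by
  funext ω
  obtain ⟨n, j, k⟩ := ω
  fin_cases j
  · simp only [Fin.zero_eta, tubeFun_zero]
    simp only [unfold, if_true, Fin.isValue, one_ne_zero, if_false, bloch, block_fst,
      PiLp.add_apply,
      hop_apply, pot_apply, periodic_val hV₀, mul_add, Finset.mul_sum]
    congr 1
    · refine Finset.sum_congr rfl fun i _ => ?_
      rw [← mul_assoc, ← Complex.exp_add]
      congr 1
      · congr 1; push_cast; ring
      · simp [proj]
    · ring
  · simp only [Fin.mk_one, tubeFun_one]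
    simp only [unfold, if_true, Fin.isValue, one_ne_zero, if_false, bloch, block_snd,
      PiLp.add_apply,
      hop_apply, pot_apply, periodic_val hV₁, mul_add, Finset.mul_sum]
    congr 1
    · refine Finset.sum_congr rfl fun i _ => ?_
      rw [← mul_assoc, ← Complex.exp_add]
      congr 1
      · congr 1; push_cast; simp; ring
      · simp [proj, sub_eq_add_neg]
    · ring

/-- Eigenvalues of the Bloch Hamiltonians lie in the spectrum. -/
lemma noEigen_bloch {t : Fin 3 → ℤ × ZMod N} (ht : ∀ i, |(t i).1| ≤ 1) {V₀ V₁ : ℤ → ℝ}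
    (hV₀ : ∀ n, V₀ (n + p) = V₀ n) (hV₁ : ∀ n, V₁ (n + p) = V₁ n)
    {T T₀ : L2 (Vertex N) →L[ℂ] L2 (Vertex N)} (hT : IsTube t V₀ V₁ T) (hT₀ : IsTube t 0 0 T₀)
    {E : ℝ} (hE : E ∉ realSpectrum T) (κ : ℝ) :
    NoEigen (bloch t V₀ V₁ κ : WithLp 2 (Fiber p N × Fiber p N) →L[ℂ] _) E := by
  intro x hx
  by_contra hx0
  refine hE (mem_realSpectrum_of_bounded ht hT hT₀ (f := unfold κ x) (C := ‖x.fst‖ + ‖x.snd‖)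
    ?_ ?_ ?_)
  · intro ω
    simp only [unfold]
    rw [norm_mul,
      show (κ : ℂ) * ω.1 * Complex.I = ((κ * ω.1 : ℝ) : ℂ) * Complex.I by push_cast; rfl,
      Complex.norm_exp_ofReal_mul_I, one_mul]
    split_ifs
    · exact (PiLp.norm_apply_le x.fst _).trans (by linarith [norm_nonneg x.snd])
    · exact (PiLp.norm_apply_le x.snd _).trans (by linarith [norm_nonneg x.fst])
  · intro h0
    apply hx0
    have h1 : ∀ (j : Fin 2) (y : ZMod p × ZMod N), (if j = 0 then x.fst y else x.snd y) = 0 := by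
      intro j y
      have h2 := congrFun h0 ((y.1.val : ℤ), j, y.2)
      simp only [unfold, Pi.zero_apply, mul_eq_zero, Complex.exp_ne_zero, false_or] at h2
      simpa using h2
    refine WithLp.ofLp_injective 2 (Prod.ext ?_ ?_)
    · ext y; simpa using h1 0 y
    · ext y; simpa using h1 1 y
  · intro ω
    rw [tubeFun_unfold t hV₀ hV₁, hx]
    simp only [unfold]
    split_ifs <;> simp [mul_left_comm]

end Nanotube

end

/-! ### The Floquet transform: from all Bloch Hamiltonians back to the tube. -/

noncomputable section

namespace Nanotube

lemma integral_exp_int (l : ℤ) :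
    ∫ κ in (0 : ℝ)..2 * Real.pi, Complex.exp (l * κ * Complex.I) =
      if l = 0 then ((2 * Real.pi : ℝ) : ℂ) else 0 := by
  split_ifs with h
  · simp [h]
  · have hc : (l * Complex.I : ℂ) ≠ 0 := mul_ne_zero (by exact_mod_cast h) Complex.I_ne_zero
    have h1 := integral_exp_mul_complex (a := 0) (b := 2 * Real.pi) hc
    simp only [mul_right_comm _ Complex.I] at h1
    rw [h1]
    have h2 : Complex.exp (l * ((2 * Real.pi : ℝ) : ℂ) * Complex.I) = 1 := by
      rw [Complex.exp_eq_one_iff]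
      exact ⟨l, by push_cast; ring⟩
    rw [h2]
    simp

/-- Parseval's identity for trigonometric polynomials. -/
lemma integral_norm_sq_trigPoly (s : Finset ℤ) (a : ℤ → ℂ) :
    ∫ κ in (0 : ℝ)..2 * Real.pi, ‖∑ m ∈ s, Complex.exp (-(κ * m * Complex.I)) * a m‖ ^ 2 =
      2 * Real.pi * ∑ m ∈ s, ‖a m‖ ^ 2 := by
  have h1 : ∀ κ : ℝ, ((‖∑ m ∈ s, Complex.exp (-(κ * m * Complex.I)) * a m‖ ^ 2 : ℝ) : ℂ) =
      ∑ m ∈ s, ∑ m' ∈ s, Complex.exp ((m - m' : ℤ) * κ * Complex.I) *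
        (starRingEnd ℂ (a m) * a m') := by
    intro κ
    push_cast
    rw [← Complex.conj_mul', map_sum, Finset.sum_mul_sum]
    refine Finset.sum_congr rfl fun m _ => Finset.sum_congr rfl fun m' _ => ?_
    rw [map_mul, ← Complex.exp_conj, mul_mul_mul_comm, ← Complex.exp_add]
    congr 2
    simp
    ring
  apply Complex.ofReal_injective
  rw [← intervalIntegral.integral_ofReal]
  simp_rw [h1]
  rw [intervalIntegral.integral_finsetSum
    (fun m _ => (by fun_prop : Continuous _).intervalIntegrable _ _)]
  rw [Complex.ofReal_mul, Complex.ofReal_sum, Finset.mul_sum]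
  refine Finset.sum_congr rfl fun m hm => ?_
  rw [intervalIntegral.integral_finsetSum
    (fun m _ => (by fun_prop : Continuous _).intervalIntegrable _ _)]
  simp_rw [intervalIntegral.integral_mul_const, integral_exp_int]
  rw [Finset.sum_eq_single m]
  · rw [Complex.conj_mul']; simp
  · intro b _ hb
    rw [if_neg (by omega), zero_mul]
  · exact fun h => absurd hm h

/-- Compactness of `I` times the unit sphere provides one `r` for all quasimomenta, as needed to
integrate the bound over `κ`. -/
lemma exists_bound_of_noEigen {H : Type*} [NormedAddCommGroup H] [InnerProductSpace ℂ H]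
    [FiniteDimensional ℂ H] {K : ℝ → H →L[ℂ] H} (hK : Continuous K) {E : ℝ}
    (hE : ∀ κ, NoEigen (K κ) E) {I : Set ℝ} (hI : IsCompact I) :
    ∃ r : ℝ, 0 < r ∧ ∀ κ ∈ I, ∀ x, r * ‖x‖ ≤ ‖K κ x - (E : ℂ) • x‖ := by
  have hcont : Continuous fun z : ℝ × H => ‖K z.1 z.2 - (E : ℂ) • z.2‖ := by fun_prop
  have : ProperSpace H := FiniteDimensional.proper ℂ H
  obtain ⟨r, hr, hr'⟩ : ∃ r : ℝ, 0 < r ∧ ∀ z ∈ I ×ˢ Metric.sphere (0 : H) 1,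
      r ≤ ‖K z.1 z.2 - (E : ℂ) • z.2‖ := by
    refine (hI.prod (isCompact_sphere _ _)).exists_forall_le' hcont.continuousOn fun z hz => ?_
    rw [norm_pos_iff, sub_ne_zero]
    intro h
    have h2 := hz.2
    rw [hE _ _ h] at h2
    simp at h2
  refine ⟨r, hr, fun κ hκ x => ?_⟩
  rcases eq_or_ne x 0 with rfl | hx
  · simp
  have h1 := hr' (κ, (‖x‖ : ℂ)⁻¹ • x) ⟨hκ, by simp [norm_smul, norm_ne_zero_iff.2 hx]⟩
  simp only [map_smul] at h1
  rw [smul_comm, ← smul_sub, norm_smul, norm_inv, Complex.norm_real, norm_norm,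
    inv_mul_eq_div, le_div_iff₀ (norm_pos_iff.2 hx)] at h1
  exact h1

variable {p N : ℕ}

/-- The Fourier transform at quasimomentum `κ` of a function supported over `s`. -/
def fold (s : Finset ℤ) (g : ℤ → ZMod N → ℂ) (κ : ℝ) : Fiber p N := WithLp.toLp 2 fun x =>
  ∑ m ∈ s, Complex.exp (-(κ * m * Complex.I)) * (if (m : ZMod p) = x.1 then g m x.2 else 0)

lemma fold_apply (s : Finset ℤ) (g : ℤ → ZMod N → ℂ) (κ : ℝ) (x : ZMod p × ZMod N) :
    fold s g κ x = ∑ m ∈ s, Complex.exp (-(κ * m * Complex.I)) *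
      (if (m : ZMod p) = x.1 then g m x.2 else 0) := rfl

lemma continuous_fold (s : Finset ℤ) (g : ℤ → ZMod N → ℂ) :
    Continuous (fold s g : ℝ → Fiber p N) := by
  unfold fold
  refine (PiLp.continuous_toLp 2 _).comp (continuous_pi fun x => ?_)
  fun_prop

/-- Parseval on the full circle of `κ`. Each site `m` contributes to the residue class of `m` alone,
so no factor `p` appears. -/
lemma integral_norm_sq_fold [NeZero p] [NeZero N] (s : Finset ℤ) (g : ℤ → ZMod N → ℂ) :
    ∫ κ in (0 : ℝ)..2 * Real.pi, ‖(fold s g κ : Fiber p N)‖ ^ 2 =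
      2 * Real.pi * ∑ m ∈ s, ∑ k, ‖g m k‖ ^ 2 := by
  simp_rw [EuclideanSpace.norm_sq_eq, fold_apply]
  rw [intervalIntegral.integral_finsetSum
    (fun m _ => (by fun_prop : Continuous _).intervalIntegrable _ _)]
  simp_rw [integral_norm_sq_trigPoly]
  rw [← Finset.mul_sum, Finset.sum_comm]
  congr 1
  refine Finset.sum_congr rfl fun m _ => ?_
  rw [Fintype.sum_prod_type_right]
  refine Finset.sum_congr rfl fun k _ => ?_
  rw [Finset.sum_eq_single (m : ZMod p)]
  · simp
  · intro b _ hb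
    simp [hb.symm]
  · simp

lemma fold_mono {s s' : Finset ℤ} (h : s ⊆ s') {g : ℤ → ZMod N → ℂ} (hg : ∀ m ∉ s, ∀ k, g m k = 0)
    (κ : ℝ) : (fold s g κ : Fiber p N) = fold s' g κ := by
  ext x
  rw [fold_apply, fold_apply]
  refine Finset.sum_subset h fun m _ hm => ?_
  simp [hg m hm]

lemma fold_shift [NeZero p] [NeZero N] {s s' : Finset ℤ} {g : ℤ → ZMod N → ℂ}
    (hg : ∀ m ∉ s, ∀ k, g m k = 0) (a : ℤ × ZMod N) (hs : ∀ m ∈ s, m - a.1 ∈ s') (κ : ℝ) :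
    (fold s' (fun m k => g (m + a.1) (k + a.2)) κ : Fiber p N) =
      Complex.exp (κ * a.1 * Complex.I) • shift (proj a) (fold s g κ) := by
  ext x
  rw [PiLp.smul_apply, shift_apply, fold_apply, fold_apply, smul_eq_mul, Finset.mul_sum]
  symm
  refine Finset.sum_of_injOn (fun m => m - a.1) (fun m _ m' _ h => by simpa using h)
    (fun m hm => hs m hm) ?_ ?_
  · intro m _ hm
    have : m + a.1 ∉ s := fun h => hm ⟨m + a.1, h, by simp⟩
    simp [hg _ this]
  · intro m _
    rw [← mul_assoc, ← Complex.exp_add]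
    congr 1
    · congr 1; push_cast; ring
    · by_cases h : (m : ZMod p) = x.1 + a.1 <;> simp [proj, sub_eq_iff_eq_add, h]

lemma fold_pot [NeZero p] [NeZero N] (s : Finset ℤ) (g : ℤ → ZMod N → ℂ) {V : ℤ → ℝ}
    (hV : ∀ n, V (n + p) = V n) (κ : ℝ) : (fold s (fun m k => V m * g m k) κ : Fiber p N) = pot V (fold s g κ) := by
  ext x
  rw [pot_apply, fold_apply, fold_apply, Finset.mul_sum]
  refine Finset.sum_congr rfl fun m _ => ?_
  split_ifs with h
  · rw [← h, periodic_val hV]; ring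
  · simp

lemma fold_add (s : Finset ℤ) (g h : ℤ → ZMod N → ℂ) (κ : ℝ) :
    (fold s (fun m k => g m k + h m k) κ : Fiber p N) = fold s g κ + fold s h κ := by
  ext x
  rw [PiLp.add_apply, fold_apply, fold_apply, fold_apply, ← Finset.sum_add_distrib]
  refine Finset.sum_congr rfl fun m _ => ?_
  split_ifs <;> ring

lemma fold_sub_mul (s : Finset ℤ) (g h : ℤ → ZMod N → ℂ) (c : ℂ) (κ : ℝ) :
    (fold s (fun m k => g m k - c * h m k) κ : Fiber p N) = fold s g κ - c • fold s h κ := by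
  ext x
  rw [PiLp.sub_apply, PiLp.smul_apply, fold_apply, fold_apply, fold_apply, smul_eq_mul,
    Finset.mul_sum, ← Finset.sum_sub_distrib]
  refine Finset.sum_congr rfl fun m _ => ?_
  split_ifs <;> ring

variable [NeZero p] [NeZero N]

lemma fold_hop {s s' : Finset ℤ} (hss : s ⊆ s') {g h : ℤ → ZMod N → ℂ}
    (hg : ∀ m ∉ s, ∀ k, g m k = 0) (hh : ∀ m ∉ s, ∀ k, h m k = 0) (t : Fin 3 → ℤ × ZMod N)
    (hs : ∀ m ∈ s, ∀ i, m - (t i).1 ∈ s') {V : ℤ → ℝ} (hV : ∀ n, V (n + p) = V n) (κ : ℝ) :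
    (fold s' (fun m k => ∑ i, g (m + (t i).1) (k + (t i).2) + V m * h m k) κ : Fiber p N) =
      hop t κ (fold s g κ) + pot V (fold s h κ) := by
  have h1 : ∀ i, _ := fun i => fold_shift (p := p) hg (t i) (fun m hm => hs m hm i) κ
  rw [fold_add, fold_pot _ _ hV, ← fold_mono hss hh]
  congr 1
  simp only [Fin.sum_univ_three]
  rw [fold_add, fold_add, h1, h1, h1]
  simp [hop, Fin.sum_univ_three]

lemma L2_norm_sq_eq_of_support {f : L2 (Vertex N)} {s : Finset ℤ}
    (hf : ∀ m ∉ s, ∀ j k, f (m, j, k) = 0) :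
    ‖f‖ ^ 2 = ∑ m ∈ s, ∑ k, ‖f (m, 0, k)‖ ^ 2 + ∑ m ∈ s, ∑ k, ‖f (m, 1, k)‖ ^ 2 := by
  rw [norm_sq_eq_tsum, tsum_eq_sum (s := s ×ˢ Finset.univ), Finset.sum_product,
    ← Finset.sum_add_distrib]
  · refine Finset.sum_congr rfl fun m _ => ?_
    rw [Fintype.sum_prod_type, Fin.sum_univ_two]
  · rintro ⟨m, j, k⟩ hm
    rw [hf m (by simpa using hm)]
    simp

/-- Lower bounds for the Bloch Hamiltonians pass to functions of finite support. -/
lemma bound_of_finite_support {t : Fin 3 → ℤ × ZMod N} (ht : ∀ i, |(t i).1| ≤ 1) {V₀ V₁ : ℤ → ℝ}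
    (hV₀ : ∀ n, V₀ (n + p) = V₀ n) (hV₁ : ∀ n, V₁ (n + p) = V₁ n)
    {T : L2 (Vertex N) →L[ℂ] L2 (Vertex N)} (hT : IsTube t V₀ V₁ T) {E r : ℝ} (hr : 0 ≤ r)
    (hb : ∀ κ ∈ Icc 0 (2 * Real.pi), ∀ x : WithLp 2 (Fiber p N × Fiber p N),
      r * ‖x‖ ≤ ‖bloch t V₀ V₁ κ x - (E : ℂ) • x‖)
    {f : L2 (Vertex N)} {s : Finset ℤ} (hf : ∀ m ∉ s, ∀ j k, f (m, j, k) = 0) :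
    r * ‖f‖ ≤ ‖T f - (E : ℂ) • f‖ := by
  -- One axial step in each direction is added to `s`, so that `s'` also carries the support of `(T
  -- - E) f`.
  set s' : Finset ℤ := s ∪ (s.image (· - 1) ∪ s.image (· + 1)) with hs'
  have hss : s ⊆ s' := Finset.subset_union_left
  have hd : ∀ m ∈ s, ∀ d : ℤ, |d| ≤ 1 → m + d ∈ s' := by
    intro m hm d hd
    rw [abs_le] at hd
    have : d = -1 ∨ d = 0 ∨ d = 1 := by omega
    simp only [hs', Finset.mem_union, Finset.mem_image]
    rcases this with rfl | rfl | rfl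
    · exact Or.inr (Or.inl ⟨m, hm, by ring⟩)
    · exact Or.inl (by simpa using hm)
    · exact Or.inr (Or.inr ⟨m, hm, by ring⟩)
  have hnot : ∀ m ∉ s', ∀ d : ℤ, |d| ≤ 1 → m + d ∉ s := fun m hm d hd' h =>
    hm (by simpa using hd _ h (-d) (by simpa using hd'))
  set h : L2 (Vertex N) := T f - (E : ℂ) • f with hh
  have hω : ∀ ω, h ω = tubeFun t V₀ V₁ f ω - E * f ω := fun ω => by
    rw [← hT.apply_eq]; rfl
  have hsupp : ∀ m ∉ s', ∀ j k, h (m, j, k) = 0 := by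
    intro m hm j k
    have h0 : m ∉ s := fun h => hm (hss h)
    rw [hω, hf m h0]
    fin_cases j
    · simp only [Fin.zero_eta, tubeFun_zero]
      rw [hf m h0, Finset.sum_eq_zero fun i _ => hf _ (hnot m hm _ (ht i)) _ _]
      simp
    · simp only [Fin.mk_one, tubeFun_one]
      rw [hf m h0, Finset.sum_eq_zero fun i _ => ?_]
      · simp
      · rw [sub_eq_add_neg]
        exact hf _ (hnot m hm _ (by simpa using ht i)) _ _
  set x : ℝ → WithLp 2 (Fiber p N × Fiber p N) := fun κ =>
    WithLp.toLp 2 (fold s (fun m k => f (m, 0, k)) κ, fold s (fun m k => f (m, 1, k)) κ) with hx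
  set y : ℝ → WithLp 2 (Fiber p N × Fiber p N) := fun κ =>
    WithLp.toLp 2 (fold s' (fun m k => h (m, 0, k)) κ, fold s' (fun m k => h (m, 1, k)) κ) with hy
  -- The transform turns `T - E` into `bloch t V₀ V₁ κ - E`; the bound for each `κ` is then squared
  -- and integrated.
  have hxy : ∀ κ, bloch t V₀ V₁ κ (x κ) - (E : ℂ) • x κ = y κ := by
    intro κ
    refine WithLp.ofLp_injective 2 (Prod.ext ?_ ?_)
    · have e : (y κ).fst = fold s' (fun m k => (∑ i, f (m + (t i).1, 1, k + (t i).2)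
          + V₀ m * f (m, 0, k)) - E * f (m, 0, k)) κ := by
        simp only [hy, hω, tubeFun_zero]
        rfl
      have e' := fold_hop (p := p) hss (g := fun m k => f (m, 1, k)) (h := fun m k => f (m, 0, k))
        (fun m hm k => hf m hm 1 k) (fun m hm k => hf m hm 0 k) t
        (fun m hm i => by rw [sub_eq_add_neg]; exact hd m hm _ (by simpa using ht i)) hV₀ κ
      have e'' := fold_mono (p := p) hss (g := fun m k => f (m, 0, k))
        (fun m hm k => hf m hm 0 k) κ
      change hop t κ (x κ).snd + pot V₀ (x κ).fst - (E : ℂ) • (x κ).fst = (y κ).fst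
      rw [e, fold_sub_mul, e', ← e'']
      rfl
    · have e : (y κ).snd = fold s' (fun m k => (∑ i, f (m + ((-t) i).1, 0, k + ((-t) i).2)
          + V₁ m * f (m, 1, k)) - E * f (m, 1, k)) κ := by
        simp only [hy, hω, tubeFun_one, sub_eq_add_neg _ (t _).1, sub_eq_add_neg _ (t _).2,
          Pi.neg_apply, Prod.fst_neg, Prod.snd_neg]
        rfl
      have e' := fold_hop (p := p) hss (g := fun m k => f (m, 0, k)) (h := fun m k => f (m, 1, k))
        (fun m hm k => hf m hm 0 k) (fun m hm k => hf m hm 1 k) (-t)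
        (fun m hm i => by rw [sub_eq_add_neg]; exact hd m hm _ (by simpa using ht i)) hV₁ κ
      have e'' := fold_mono (p := p) hss (g := fun m k => f (m, 1, k))
        (fun m hm k => hf m hm 1 k) κ
      change hop (-t) κ (x κ).fst + pot V₁ (x κ).snd - (E : ℂ) • (x κ).snd = (y κ).snd
      rw [e, fold_sub_mul, e', ← e'']
      rfl
  have hxn : ∀ κ, ‖x κ‖ ^ 2 = ‖(fold s (fun m k => f (m, 0, k)) κ : Fiber p N)‖ ^ 2 +
      ‖(fold s (fun m k => f (m, 1, k)) κ : Fiber p N)‖ ^ 2 := fun κ => by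
    rw [WithLp.prod_norm_sq_eq_of_L2]
    rfl
  have hyn : ∀ κ, ‖y κ‖ ^ 2 = ‖(fold s' (fun m k => h (m, 0, k)) κ : Fiber p N)‖ ^ 2 +
      ‖(fold s' (fun m k => h (m, 1, k)) κ : Fiber p N)‖ ^ 2 := fun κ => by
    rw [WithLp.prod_norm_sq_eq_of_L2]
    rfl
  have hint : ∀ (s : Finset ℤ) (g : ℤ → ZMod N → ℂ), IntervalIntegrable
      (fun κ => ‖(fold s g κ : Fiber p N)‖ ^ 2) MeasureTheory.volume 0 (2 * Real.pi) :=
    fun s g => ((continuous_fold s g).norm.pow 2).intervalIntegrable _ _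
  have hX : ∫ κ in (0 : ℝ)..2 * Real.pi, ‖x κ‖ ^ 2 = 2 * Real.pi * ‖f‖ ^ 2 := by
    simp_rw [hxn]
    rw [intervalIntegral.integral_add (hint _ _) (hint _ _), integral_norm_sq_fold,
      integral_norm_sq_fold, L2_norm_sq_eq_of_support hf, mul_add]
  have hY : ∫ κ in (0 : ℝ)..2 * Real.pi, ‖y κ‖ ^ 2 = 2 * Real.pi * ‖h‖ ^ 2 := by
    simp_rw [hyn]
    rw [intervalIntegral.integral_add (hint _ _) (hint _ _), integral_norm_sq_fold,
      integral_norm_sq_fold, L2_norm_sq_eq_of_support hsupp, mul_add]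
  have hle : ∫ κ in (0 : ℝ)..2 * Real.pi, r ^ 2 * ‖x κ‖ ^ 2 ≤
      ∫ κ in (0 : ℝ)..2 * Real.pi, ‖y κ‖ ^ 2 := by
    refine intervalIntegral.integral_mono_on (by positivity) ?_ ?_ fun κ hκ => ?_
    · simp_rw [hxn]
      exact ((hint _ _).add (hint _ _)).const_mul _
    · simp_rw [hyn]
      exact (hint _ _).add (hint _ _)
    · rw [← mul_pow, ← hxy]
      exact pow_le_pow_left₀ (by positivity) (hb κ hκ _) 2
  rw [intervalIntegral.integral_const_mul, hX, hY, mul_left_comm, ← mul_pow] at hle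
  exact (sq_le_sq₀ (by positivity) (norm_nonneg _)).1 (le_of_mul_le_mul_left hle (by positivity))

/-- An energy that is not an eigenvalue of any Bloch Hamiltonian is not in the spectrum. -/
lemma notMem_realSpectrum {t : Fin 3 → ℤ × ZMod N} (ht : ∀ i, |(t i).1| ≤ 1) {V₀ V₁ : ℤ → ℝ}
    (hV₀ : ∀ n, V₀ (n + p) = V₀ n) (hV₁ : ∀ n, V₁ (n + p) = V₁ n)
    {T : L2 (Vertex N) →L[ℂ] L2 (Vertex N)} (hT : IsTube t V₀ V₁ T) {E : ℝ}
    (hE : ∀ κ, NoEigen (bloch t V₀ V₁ κ : WithLp 2 (Fiber p N × Fiber p N) →L[ℂ] _) E) :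
    E ∉ realSpectrum T := by
  obtain ⟨r, hr, hb⟩ := exists_bound_of_noEigen (continuous_bloch t V₀ V₁) hE
    (isCompact_Icc (a := 0) (b := 2 * Real.pi))
  refine notMem_spectrum_of_bound hT.selfAdjoint hr fun f => ?_
  -- Finite sums of point masses converge to `f`, so the bound for finite support extends by
  -- continuity.
  have hsum := lp.hasSum_single (p := 2) (by norm_num) f
  refine le_of_tendsto_of_tendsto ((hsum.norm).const_mul r)
    (((T.continuous.tendsto f).comp hsum).sub (Filter.Tendsto.const_smul hsum (E : ℂ))).norm
    (Eventually.of_forall fun S => ?_)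
  refine bound_of_finite_support ht hV₀ hV₁ hT hr.le hb (s := S.image Prod.fst) fun m hm j k => ?_
  rw [lp.coeFn_sum, Finset.sum_apply]
  refine Finset.sum_eq_zero fun ω hω => ?_
  rw [lp.single_apply, Pi.single_eq_of_ne]
  rintro rfl
  exact hm (Finset.mem_image_of_mem Prod.fst hω)

end Nanotube

end

/-! ### Counting gaps, and stabilization of the maximum. -/

noncomputable section

namespace Nanotube

lemma isClosed_realSpectrum {ι : Type} (T : L2 ι →L[ℂ] L2 ι) : IsClosed (realSpectrum T) :=
  (spectrum.isClosed (𝕜 := ℂ) T).preimage Complex.continuous_ofReal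

section Gaps

variable {S : Set ℝ} {lo hi : ℝ} {I J : ℝ × ℝ}

/-- The endpoints of a gap lie in `S`, so none of them can fall inside the other gap. -/
lemma openGaps_eq_of_overlap (hI : I ∈ openGaps S lo hi) (hJ : J ∈ openGaps S lo hi)
    (h₁ : I.1 < J.2) (h₂ : J.1 < I.2) : I = J := by
  obtain ⟨hI1, ⟨hI2, -⟩, ⟨hI3, -⟩, hI4⟩ := hI
  obtain ⟨hJ1, ⟨hJ2, -⟩, ⟨hJ3, -⟩, hJ4⟩ := hJ
  rw [Set.disjoint_left] at hI4 hJ4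
  have a1 : I.2 ≤ J.2 := not_lt.1 fun h => hI4 ⟨h₁, h⟩ hJ3
  have a2 : J.2 ≤ I.2 := not_lt.1 fun h => hJ4 ⟨h₂, h⟩ hI3
  have a3 : J.1 ≤ I.1 := not_lt.1 fun h => hI4 ⟨h, h₂⟩ hJ2
  have a4 : I.1 ≤ J.1 := not_lt.1 fun h => hJ4 ⟨h, h₁⟩ hI2
  exact Prod.ext (le_antisymm a4 a3) (le_antisymm a1 a2)

/-- If any two points off `S` that enclose a point of `S` enclose a point of `Q`, and `Q` has at
most `K` points below `hi`, then `S` has at most `K + 1` gaps in `[lo, hi]`. -/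
lemma encard_openGaps_le {Q : Set ℝ} {K : ℕ}
    (hQ : ∀ E₁ E₂ s, E₁ ∉ S → E₂ ∉ S → s ∈ S → E₁ < s → s < E₂ → ∃ μ ∈ Q, E₁ < μ ∧ μ < E₂)
    (hK : ∀ s : Finset ℝ, (∀ μ ∈ s, μ < hi ∧ μ ∈ Q) → s.card ≤ K) :
    (openGaps S lo hi).encard ≤ ((K + 1 : ℕ) : ℕ∞) := by
  set R : ℝ → Set ℝ := fun e => {μ | μ < e ∧ μ ∈ Q} with hR
  have hfin : (R hi).Finite := by
    by_contra h
    obtain ⟨s, hs, hc⟩ := Set.Infinite.exists_subset_card_eq h (K + 1)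
    have := hK s fun μ hμ => hs hμ
    omega
  have hcard : (R hi).ncard ≤ K := by
    rw [Set.ncard_eq_toFinset_card _ hfin]
    exact hK _ fun μ hμ => hfin.mem_toFinset.1 hμ
  have hsub : ∀ e, e ≤ hi → R e ⊆ R hi := fun e he μ hμ => ⟨hμ.1.trans_le he, hμ.2⟩
  set m : ℝ × ℝ → ℝ := fun I => (I.1 + I.2) / 2 with hm
  have hm1 : ∀ I ∈ openGaps S lo hi, I.1 < m I ∧ m I < I.2 ∧ m I ∉ S ∧ m I ≤ hi := by
    rintro I ⟨h1, -, ⟨-, -, h2⟩, h3⟩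
    have h4 : I.1 < m I := by simp only [hm]; linarith
    have h5 : m I < I.2 := by simp only [hm]; linarith
    exact ⟨h4, h5, Set.disjoint_left.1 h3 ⟨h4, h5⟩, by linarith⟩
  -- The endpoint `I.2` is a point of `S` between the two midpoints, so some point of `Q` separates
  -- them. The number of points of `Q` below the midpoint thus labels the gaps injectively, with
  -- values from `0` to `K`.
  have hlt : ∀ I ∈ openGaps S lo hi, ∀ J ∈ openGaps S lo hi, I.2 ≤ J.1 →
      (R (m I)).ncard < (R (m J)).ncard := by
    intro I hI J hJ hIJ
    obtain ⟨a1, a2, a3, a4⟩ := hm1 I hI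
    obtain ⟨b1, b2, b3, b4⟩ := hm1 J hJ
    obtain ⟨μ, hμQ, hμ1, hμ2⟩ := hQ (m I) (m J) I.2 a3 b3 hI.2.2.1.1 a2 (hIJ.trans_lt b1)
    have hss : R (m I) ⊆ R (m J) := fun ν hν => ⟨hν.1.trans (hμ1.trans hμ2), hν.2⟩
    refine Set.ncard_lt_ncard ?_ (hfin.subset (hsub _ b4))
    refine (Set.ssubset_iff_of_subset hss).2
      ⟨μ, ⟨hμ2, hμQ⟩, fun h => absurd h.1 (not_lt.2 hμ1.le)⟩
  have hinj : Set.InjOn (fun I => (R (m I)).ncard) (openGaps S lo hi) := by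
    intro I hI J hJ h
    by_contra hne
    rcases lt_or_ge I.1 J.2 with h1 | h1
    · rcases lt_or_ge J.1 I.2 with h2 | h2
      · exact hne (openGaps_eq_of_overlap hI hJ h1 h2)
      · exact (hlt I hI J hJ h2).ne h
    · exact (hlt J hJ I hI h1).ne' h
  have hmaps : Set.MapsTo (fun I => (R (m I)).ncard) (openGaps S lo hi)
      (Finset.range (K + 1) : Finset ℕ) := by
    intro I hI
    rw [Finset.mem_coe, Finset.mem_range, Nat.lt_succ_iff]
    exact (Set.ncard_le_ncard (hsub _ (hm1 I hI).2.2.2) hfin).trans hcard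
  have := Set.encard_le_encard_of_injOn hmaps hinj
  rwa [Set.encard_coe_eq_coe_finsetCard, Finset.card_range] at this

/-- A point off the closed set `S` between points of `S` lies in a gap. -/
lemma exists_openGap (hS : IsClosed S) {s e u : ℝ} (hs : s ∈ S) (hu : u ∈ S) (he : e ∉ S)
    (hlo : lo ≤ s) (hhi : u ≤ hi) (hse : s < e) (heu : e < u) :
    ∃ I ∈ openGaps S lo hi, s ≤ I.1 ∧ I.1 < e ∧ e < I.2 ∧ I.2 ≤ u := by
  have c1 : IsCompact (S ∩ Icc s e) := isCompact_Icc.inter_left hS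
  have c2 : IsCompact (S ∩ Icc e u) := isCompact_Icc.inter_left hS
  obtain ⟨a, ha, ha'⟩ := c1.exists_isGreatest ⟨s, hs, le_rfl, hse.le⟩
  obtain ⟨b, hb, hb'⟩ := c2.exists_isLeast ⟨u, hu, heu.le, le_rfl⟩
  have hae : a < e := lt_of_le_of_ne ha.2.2 fun h => he (h ▸ ha.1)
  have heb : e < b := lt_of_le_of_ne hb.2.1 fun h => he (h ▸ hb.1)
  have h1 := ha.2.1
  have h2 := hb.2.2
  refine ⟨(a, b), ⟨hae.trans heb, ⟨ha.1, by linarith, by linarith⟩, ⟨hb.1, by linarith,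
    by linarith⟩, ?_⟩, h1, hae, heb, h2⟩
  rw [Set.disjoint_left]
  rintro y ⟨hy1, hy2⟩ hyS
  simp only at hy1 hy2
  rcases le_total y e with h | h
  · exact absurd (ha' ⟨hyS, by linarith, h⟩) (not_le.2 hy1)
  · exact absurd (hb' ⟨hyS, h, by linarith⟩) (not_le.2 hy2)

/-- Gaps are counted from below by interlacing points on and off `S`. -/
lemma le_encard_openGaps (hS : IsClosed S) {M : ℕ} {l e : ℕ → ℝ} (hl : ∀ j ≤ M, l j ∈ S)
    (he : ∀ j < M, e j ∉ S ∧ l j < e j ∧ e j < l (j + 1))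
    (hlo : ∀ j ≤ M, lo ≤ l j) (hhi : ∀ j ≤ M, l j ≤ hi) :
    (M : ℕ∞) ≤ (openGaps S lo hi).encard := by
  have h1 : ∀ j : Fin M, ∃ I ∈ openGaps S lo hi, l j ≤ I.1 ∧ I.2 ≤ l (j + 1) := fun j => by
    obtain ⟨I, hI, h1, -, -, h2⟩ := exists_openGap (lo := lo) (hi := hi) hS
      (hl j (by omega)) (hl (j + 1) (by omega)) (he j j.2).1 (hlo j (by omega))
      (hhi (j + 1) (by omega)) (he j j.2).2.1 (he j j.2).2.2
    exact ⟨I, hI, h1, h2⟩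
  choose I hI hI1 hI2 using h1
  have hmono : ∀ i j : ℕ, i ≤ j → j ≤ M → l i ≤ l j := by
    intro i j hij
    induction j, hij using Nat.le_induction with
    | base => exact fun _ => le_rfl
    | succ j hij ih =>
      intro hj
      have := he j (by omega)
      linarith [ih (by omega)]
  have hinj : Function.Injective I := by
    intro i j hij
    by_contra hne
    wlog h : i < j generalizing i j
    · exact this hij.symm (Ne.symm hne) (lt_of_le_of_ne (not_lt.1 h) (Ne.symm hne))
    have h1 := hI2 i
    have h2 := hmono (i + 1) j h (by omega)
    have h3 := hI1 j
    have h4 := (hI i).1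
    rw [hij] at h1 h4
    linarith
  have h2 : Set.range I ⊆ openGaps S lo hi := by
    rintro _ ⟨j, rfl⟩
    exact hI j
  calc (M : ℕ∞) = (Set.range I).encard := by
        rw [← Set.image_univ, hinj.encard_image, Set.encard_univ, ENat.card_eq_coe_fintype_card,
          Fintype.card_fin]
    _ ≤ _ := Set.encard_le_encard h2

end Gaps

/-- If the numbers of gaps are bounded for small potentials, then their maximum stabilizes. -/
lemma exists_isMaxEdgeGapNumber {ι : Type} {H : BddSeq → (L2 ι →L[ℂ] L2 ι)} {p : ℕ} {α : ℝ}
    {ε₁ : ℝ} (hε₁ : 0 < ε₁) {lb ub : ℕ}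
    (hub : ∀ v : BddSeq, (∀ n : ℤ, v (n + 2 * (p : ℤ)) = v n) → ‖v‖ ≤ ε₁ →
      (openGaps (realSpectrum (H v)) (-3) (-3 + α)).encard ≤ (ub : ℕ∞))
    (hlb : ∀ ε, 0 < ε → ε ≤ ε₁ → ∃ v : BddSeq, (∀ n : ℤ, v (n + 2 * (p : ℤ)) = v n) ∧ ‖v‖ ≤ ε ∧
      (lb : ℕ∞) ≤ (openGaps (realSpectrum (H v)) (-3) (-3 + α)).encard) :
    ∃ G : ℕ, IsMaxEdgeGapNumber H p α G ∧ lb ≤ G ∧ G ≤ ub := by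
  classical
  set A : ℝ → Set ℕ∞ := fun ε => {m : ℕ∞ | ∃ v : BddSeq, (∀ n : ℤ, v (n + 2 * (p : ℤ)) = v n) ∧
    ‖v‖ ≤ ε ∧ m = (openGaps (realSpectrum (H v)) (-3) (-3 + α)).encard} with hA
  have hmono : ∀ ε ε', ε ≤ ε' → A ε ⊆ A ε' := by
    rintro ε ε' h m ⟨v, h1, h2, h3⟩
    exact ⟨v, h1, h2.trans h, h3⟩
  have hbd : ∀ ε ≤ ε₁, ∀ m ∈ A ε, m ≤ ub := by
    rintro ε h m ⟨v, h1, h2, rfl⟩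
    exact hub v h1 (h2.trans h)
  have hmax : ∀ ε, 0 < ε → ε ≤ ε₁ → ∃ g : ℕ, IsGreatest (A ε) (g : ℕ∞) ∧ lb ≤ g ∧ g ≤ ub := by
    intro ε h0 h1
    obtain ⟨v, hv1, hv2, hv3⟩ := hlb ε h0 h1
    have hfin : (A ε).Finite := by
      refine ((Set.finite_Iic ub).image ((↑) : ℕ → ℕ∞)).subset fun m hm => ?_
      have hmu := hbd ε h1 m hm
      lift m to ℕ using ne_top_of_le_ne_top (ENat.natCast_ne_top _) hmu
      exact ⟨m, by exact_mod_cast hmu, rfl⟩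
    have hne : (A ε).Nonempty := ⟨_, v, hv1, hv2, rfl⟩
    obtain ⟨m, hm, hm'⟩ := hfin.exists_maximal hne
    have hgr : ∀ x ∈ A ε, x ≤ m := fun x hx => (le_total x m).elim id fun h => hm' hx h
    have hmu := hbd ε h1 m hm
    lift m to ℕ using ne_top_of_le_ne_top (ENat.natCast_ne_top _) hmu
    refine ⟨m, ⟨hm, hgr⟩, ?_, by exact_mod_cast hmu⟩
    exact_mod_cast hv3.trans (hgr _ ⟨v, hv1, hv2, rfl⟩)
  -- The sets `A ε` shrink with `ε`, so their maxima are monotone natural numbers. The smallest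
  -- maximum that occurs, attained at some `ε₀`, is the maximum for every smaller `ε`.
  have hex : ∃ g : ℕ, ∃ ε, 0 < ε ∧ ε ≤ ε₁ ∧ IsGreatest (A ε) (g : ℕ∞) := by
    obtain ⟨g, hg, -⟩ := hmax ε₁ hε₁ le_rfl
    exact ⟨g, ε₁, hε₁, le_rfl, hg⟩
  obtain ⟨ε₀, h0, h1, hg⟩ := Nat.find_spec hex
  refine ⟨Nat.find hex, ⟨ε₀, h0, fun ε hε hε' => ?_⟩, ?_, ?_⟩
  · obtain ⟨g, hg', -⟩ := hmax ε hε (hε'.trans h1)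
    have h2 : Nat.find hex ≤ g := Nat.find_min' hex ⟨ε, hε, hε'.trans h1, hg'⟩
    have h3 : (g : ℕ∞) ≤ Nat.find hex := hg.2 (hmono _ _ hε' hg'.1)
    have h4 : g = Nat.find hex := le_antisymm (by exact_mod_cast h3) h2
    rwa [h4] at hg'
  all_goals
    obtain ⟨g, hg', hl, hu⟩ := hmax ε₀ h0 h1
    have h2 : g = Nat.find hex := by exact_mod_cast hg'.unique hg
    omega

section Tube

variable {p N : ℕ} [NeZero p] [NeZero N]

/-- If the fibre at `κ = 0` had no eigenvalue in the interval, continuity in `κ` would keep the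
interval free for every `κ`, because no eigenvalue comes near `E₁` or `E₂`; then `s` would be off
the spectrum. -/
lemma exists_eigenvalue_between {t : Fin 3 → ℤ × ZMod N} (ht : ∀ i, |(t i).1| ≤ 1)
    {V₀ V₁ : ℤ → ℝ} (hV₀ : ∀ n, V₀ (n + p) = V₀ n) (hV₁ : ∀ n, V₁ (n + p) = V₁ n)
    {T T₀ : L2 (Vertex N) →L[ℂ] L2 (Vertex N)} (hT : IsTube t V₀ V₁ T) (hT₀ : IsTube t 0 0 T₀)
    {E₁ E₂ s : ℝ} (h₁ : E₁ ∉ realSpectrum T) (h₂ : E₂ ∉ realSpectrum T) (hs : s ∈ realSpectrum T)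
    (h₁s : E₁ < s) (hs₂ : s < E₂) :
    ∃ μ, ¬ NoEigen (bloch t V₀ V₁ 0 : WithLp 2 (Fiber p N × Fiber p N) →L[ℂ] _) μ ∧
      E₁ < μ ∧ μ < E₂ := by
  by_contra! hc
  have hopen := (isClosed_realSpectrum T).isOpen_compl
  obtain ⟨δ₁, hδ₁, hb₁⟩ := Metric.isOpen_iff.1 hopen E₁ h₁
  obtain ⟨δ₂, hδ₂, hb₂⟩ := Metric.isOpen_iff.1 hopen E₂ h₂
  have key := noEigen_Ioo_of_continuous (K := (bloch t V₀ V₁ : ℝ →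
    WithLp 2 (Fiber p N × Fiber p N) →L[ℂ] _)) (continuous_bloch t V₀ V₁)
    (isSymmetric_bloch t V₀ V₁) (h₁s.trans hs₂) (lt_min hδ₁ hδ₂)
    (fun κ μ hμ => noEigen_bloch ht hV₀ hV₁ hT hT₀ (hb₁ (by
      rw [Metric.mem_ball, Real.dist_eq]; exact hμ.trans_le (min_le_left _ _))) κ)
    (fun κ μ hμ => noEigen_bloch ht hV₀ hV₁ hT hT₀ (hb₂ (by
      rw [Metric.mem_ball, Real.dist_eq]; exact hμ.trans_le (min_le_right _ _))) κ)
    (κ₀ := 0) (fun μ hμ => by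
      by_contra h
      exact absurd (hc μ h hμ.1) (not_le.2 hμ.2))
  exact notMem_realSpectrum ht hV₀ hV₁ hT (fun κ => key κ s ⟨h₁s, hs₂⟩) hs

end Tube

end Nanotube

end

/-! ### Upper bound: loss of hopping amplitude, plane waves and min-max. -/

noncomputable section

namespace Nanotube

/-- For three translates of one `g`, with phases, this says that `‖hop t κ g‖²` falls short of
`9‖g‖²` exactly by the squared differences of the translates. -/
lemma norm_sq_sum_three {F : Type*} [NormedAddCommGroup F] [InnerProductSpace ℂ F] (a b c : F) :
    ‖a + b + c‖ ^ 2 + (‖a - b‖ ^ 2 + ‖b - c‖ ^ 2 + ‖a - c‖ ^ 2) =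
      3 * (‖a‖ ^ 2 + ‖b‖ ^ 2 + ‖c‖ ^ 2) := by
  simp only [@norm_add_sq ℂ, @norm_sub_sq ℂ, inner_add_left, map_add]
  ring

/-- The quadratic form of an operator that is diagonal in an orthonormal basis. -/
lemma re_inner_ge_of_diagonal {F ι : Type*} [NormedAddCommGroup F] [InnerProductSpace ℂ F]
    [Fintype ι] (b : OrthonormalBasis ι ℂ F) {A : F →L[ℂ] F} {a : ι → ℂ}
    (hA : ∀ i, A (b i) = a i • b i) {c : ℝ} (hc : 0 ≤ c) (x y : F)
    (h : ∀ i, ‖a i‖ ≤ c ∨ inner ℂ (b i) x = a i * inner ℂ (b i) y) :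
    -c * (‖x‖ ^ 2 + ‖y‖ ^ 2) ≤ 2 * (inner ℂ x (A y)).re := by
  have hAy : ∀ i, inner ℂ (b i) (A y) = a i * inner ℂ (b i) y := by
    intro i
    have h1 : A y = ∑ j, (inner ℂ (b j) y * a j) • b j := by
      conv_lhs => rw [← b.sum_repr' y]
      rw [map_sum]
      exact Finset.sum_congr rfl fun j _ => by rw [map_smul, hA, smul_smul]
    rw [h1, b.orthonormal.inner_right_fintype, mul_comm]
  rw [← b.sum_inner_mul_inner x (A y), ← b.sum_sq_norm_inner_right x, ← b.sum_sq_norm_inner_right y,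
    ← Finset.sum_add_distrib, Finset.mul_sum, Complex.re_sum, Finset.mul_sum]
  refine Finset.sum_le_sum fun i _ => ?_
  rw [hAy, ← inner_conj_symm x (b i)]
  set u := inner ℂ (b i) x
  set v := inner ℂ (b i) y
  -- Either the coefficient is small and Cauchy–Schwarz suffices, or the linear condition turns the
  -- cross term into `‖u‖² ≥ 0`.
  rcases h i with h | h
  · have h1 := Complex.abs_re_le_norm (starRingEnd ℂ u * (a i * v))
    rw [norm_mul, norm_mul, RCLike.norm_conj] at h1
    have h2 : ‖u‖ * (‖a i‖ * ‖v‖) ≤ c * (‖u‖ * ‖v‖) := by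
      rw [mul_left_comm]; gcongr
    have h3 := neg_abs_le (starRingEnd ℂ u * (a i * v)).re
    nlinarith [sq_nonneg (‖u‖ - ‖v‖)]
  · rw [← h, Complex.conj_mul', ← Complex.ofReal_pow, Complex.ofReal_re]
    nlinarith [sq_nonneg ‖u‖, sq_nonneg ‖v‖]

variable {p N : ℕ} [NeZero p] [NeZero N]

/-- Translation by `a` with the phase of quasimomentum `κ`. -/
def twist (κ : ℝ) (a : ℤ × ZMod N) : Fiber p N →L[ℂ] Fiber p N :=
  Complex.exp (κ * a.1 * Complex.I) • shift (proj a)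

lemma hop_eq_twist (t : Fin 3 → ℤ × ZMod N) (κ : ℝ) (g : Fiber p N) :
    hop t κ g = twist κ (t 0) g + twist κ (t 1) g + twist κ (t 2) g := by
  simp [hop, twist, Fin.sum_univ_three]

lemma norm_twist (κ : ℝ) (a : ℤ × ZMod N) (g : Fiber p N) : ‖twist κ a g‖ = ‖g‖ := by
  rw [twist, smul_apply, norm_smul, norm_shift,
    show (κ : ℂ) * a.1 * Complex.I = ((κ * a.1 : ℝ) : ℂ) * Complex.I by push_cast; rfl,
    Complex.norm_exp_ofReal_mul_I, one_mul]

lemma twist_twist (κ : ℝ) (a b : ℤ × ZMod N) (g : Fiber p N) :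
    twist κ a (twist κ b g) = twist κ (a + b) g := by
  simp only [twist, smul_apply, map_smul, shift_shift, smul_smul, ← Complex.exp_add]
  congr 2
  · rw [Prod.fst_add]; push_cast; ring
  · simp [proj]

lemma twist_zero (κ : ℝ) (g : Fiber p N) : twist κ 0 g = g := by
  have h : (proj (0 : ℤ × ZMod N) : ZMod p × ZMod N) = 0 := by simp [proj]
  ext x
  simp [twist, h]

lemma twist_zero_left (κ : ℝ) (k : ZMod N) (g : Fiber p N) : twist κ (0, k) g = shift (0, k) g := by
  simp [twist, proj]

/-- The bonds spread along the axis by at most one step, and are not all equivalent up to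
translations along the axis. -/
structure GoodBonds (t : Fin 3 → ℤ × ZMod N) : Prop where
  abs_le : ∀ i, |(t i).1| ≤ 1
  spread : ∀ (p : ℕ) [NeZero p] (κ : ℝ) (g : Fiber p N), ‖g - shift (0, -1) g‖ ^ 2 ≤
    2 * (‖twist κ (t 0) g - twist κ (t 1) g‖ ^ 2 + ‖twist κ (t 1) g - twist κ (t 2) g‖ ^ 2
      + ‖twist κ (t 0) g - twist κ (t 2) g‖ ^ 2)

/-- A discrete Poincaré inequality: as the rotations of `g` sum to zero, `N g` is the sum of the
differences `g - shift (0, -j) g`, and each telescopes into at most `N` single steps. -/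
lemma norm_le_of_sum_eq_zero {g : Fiber p N} (hg : ∀ n, ∑ k, g (n, k) = 0) :
    ‖g‖ ≤ N * ‖g - shift (0, -1) g‖ := by
  set D := ‖g - shift (0, -1) g‖
  have h1 : ∀ j : ℕ, ‖g - shift (0, -(j : ZMod N)) g‖ ≤ j * D := by
    intro j
    induction j with
    | zero =>
      have : shift ((0 : ZMod p), -((0 : ℕ) : ZMod N)) g = g := by
        ext x
        rw [shift_apply]
        exact congrArg g (Prod.ext (by simp) (by simp))
      rw [this]; simp
    | succ j ih =>
      have h2 : g - shift (0, -((j + 1 : ℕ) : ZMod N)) g =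
          (g - shift (0, -(j : ZMod N)) g) + shift (0, -(j : ZMod N)) (g - shift (0, -1) g) := by
        rw [map_sub, shift_shift]
        simp only [Prod.mk_add_mk, add_zero, Nat.cast_add, Nat.cast_one, neg_add]
        abel
      rw [h2]
      refine (norm_add_le _ _).trans ?_
      rw [norm_shift]
      push_cast
      linarith
  have h2 : (N : ℂ) • g = ∑ j : ZMod N, (g - shift (0, -j) g) := by
    have h3 : ∑ j : ZMod N, shift ((0 : ZMod p), -j) g = 0 := by
      ext x
      rw [PiLp.zero_apply, WithLp.ofLp_sum, Finset.sum_apply, ← hg x.1]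
      refine Fintype.sum_equiv (Equiv.subLeft x.2) _ _ fun j => ?_
      rw [shift_apply]
      exact congrArg g (Prod.ext (by simp) (by simp [sub_eq_add_neg]))
    rw [Finset.sum_sub_distrib, h3, sub_zero, Finset.sum_const, Finset.card_univ, ZMod.card,
      Nat.cast_smul_eq_nsmul]
  have h3 : (N : ℝ) * ‖g‖ ≤ N * (N * D) := by
    calc (N : ℝ) * ‖g‖ = ‖(N : ℂ) • g‖ := by rw [norm_smul, Complex.norm_natCast]
      _ ≤ ∑ j : ZMod N, ‖g - shift (0, -j) g‖ := by rw [h2]; exact norm_sum_le _ _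
      _ ≤ ∑ _j : ZMod N, (N : ℝ) * D := by
        refine Finset.sum_le_sum fun j _ => ?_
        have h4 := h1 j.val
        rw [ZMod.natCast_zmod_val] at h4
        refine h4.trans ?_
        have : (j.val : ℝ) ≤ N := by exact_mod_cast (ZMod.val_lt j).le
        gcongr
      _ = N * (N * D) := by simp [ZMod.card]
  exact le_of_mul_le_mul_left h3 (by exact_mod_cast NeZero.pos N)

/-- The loss of the hopping amplitude on functions of vanishing mean around the tube. -/
def loss (N : ℕ) : ℝ := 1 / (12 * (N : ℝ) ^ 2)

lemma loss_pos : 0 < loss N := by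
  have := NeZero.pos N
  unfold loss
  positivity

lemma loss_le : loss N ≤ 1 / 12 := by
  have : (1 : ℝ) ≤ N := by exact_mod_cast NeZero.pos N
  unfold loss
  exact one_div_le_one_div_of_le (by norm_num) (by nlinarith)

lemma norm_hop_le {t : Fin 3 → ℤ × ZMod N} (ht : GoodBonds t) (κ : ℝ) {g : Fiber p N}
    (hg : ∀ n, ∑ k, g (n, k) = 0) : ‖hop t κ g‖ ≤ (3 - loss N) * ‖g‖ := by
  have h1 := norm_sq_sum_three (twist κ (t 0) g) (twist κ (t 1) g) (twist κ (t 2) g)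
  rw [← hop_eq_twist, norm_twist, norm_twist, norm_twist] at h1
  have h2 := ht.spread p κ g
  have h3 := norm_le_of_sum_eq_zero hg
  have h4 : ‖g‖ ^ 2 ≤ (N : ℝ) ^ 2 * ‖g - shift (0, -1) g‖ ^ 2 := by
    rw [← mul_pow]; exact pow_le_pow_left₀ (norm_nonneg _) h3 2
  have hN : (0 : ℝ) < N := by exact_mod_cast NeZero.pos N
  -- This fixes the constant in `loss`: half of `‖g - shift (0, -1) g‖²` is at least `6 * loss N *
  -- ‖g‖²`, and `9 - 6 * loss N ≤ (3 - loss N) ^ 2`.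
  have h5 : 12 * loss N * ‖g‖ ^ 2 ≤ ‖g - shift (0, -1) g‖ ^ 2 := by
    rw [loss, mul_one_div, mul_comm 12, div_mul_cancel_right₀ (by norm_num),
      inv_mul_le_iff₀ (by positivity)]
    exact h4
  have h6 := loss_le (N := N)
  have h7 := loss_pos (N := N)
  refine (sq_le_sq₀ (norm_nonneg _) (mul_nonneg (by linarith) (norm_nonneg _))).1 ?_
  rw [mul_pow]
  nlinarith [mul_nonneg (sq_nonneg (loss N)) (sq_nonneg ‖g‖)]

/-- Plane waves. -/
def planeWave (q : ZMod p × ZMod N) : Fiber p N := WithLp.toLp 2 fun x =>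
  (Real.sqrt (p * N))⁻¹ * (ZMod.stdAddChar (x.1 * q.1) * ZMod.stdAddChar (x.2 * q.2))

lemma planeWave_apply (q x : ZMod p × ZMod N) : (planeWave q : Fiber p N) x =
    (Real.sqrt (p * N))⁻¹ * (ZMod.stdAddChar (x.1 * q.1) * ZMod.stdAddChar (x.2 * q.2)) := rfl

lemma orthonormal_planeWave : Orthonormal ℂ (planeWave : ZMod p × ZMod N → Fiber p N) := by
  have hp : (p : ℂ) ≠ 0 := by exact_mod_cast NeZero.ne p
  have hN : (N : ℂ) ≠ 0 := by exact_mod_cast NeZero.ne N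
  rw [orthonormal_iff_ite]
  rintro ⟨l, m⟩ ⟨l', m'⟩
  have h1 : ∀ (M : ℕ) [NeZero M] (x y : ZMod M),
      (ZMod.stdAddChar x : ℂ) * starRingEnd ℂ (ZMod.stdAddChar y) =
      ZMod.stdAddChar (x - y) := by
    intro M _ x y
    rw [← AddChar.map_neg_eq_conj, ← AddChar.map_add_eq_mul, sub_eq_add_neg]
  have h2 : ((Real.sqrt (p * N) : ℂ)⁻¹) * (Real.sqrt (p * N) : ℂ)⁻¹ = ((p : ℂ) * N)⁻¹ := by
    rw [← mul_inv, ← Complex.ofReal_mul, Real.mul_self_sqrt (by positivity)]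
    push_cast; rfl
  rw [PiLp.inner_apply]
  simp only [planeWave_apply, RCLike.inner_apply, map_mul, map_inv₀, Complex.conj_ofReal,
    Complex.ofReal_inv]
  have h3 : ∀ x : ZMod p × ZMod N,
      (Real.sqrt (p * N) : ℂ)⁻¹ * (ZMod.stdAddChar (x.1 * l') * ZMod.stdAddChar (x.2 * m')) *
        ((Real.sqrt (p * N) : ℂ)⁻¹ * (starRingEnd ℂ (ZMod.stdAddChar (x.1 * l)) *
          starRingEnd ℂ (ZMod.stdAddChar (x.2 * m)))) = ((p : ℂ) * N)⁻¹ *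
        (ZMod.stdAddChar (x.1 * (l' - l)) * ZMod.stdAddChar (x.2 * (m' - m))) := by
    intro x
    rw [mul_sub, mul_sub, ← h1, ← h1, ← h2]
    ring
  simp_rw [h3]
  rw [← Finset.mul_sum, Fintype.sum_prod_type]
  simp_rw [← Finset.mul_sum]
  rw [← Finset.sum_mul, AddChar.sum_mulShift _ (ZMod.isPrimitive_stdAddChar p),
    AddChar.sum_mulShift _ (ZMod.isPrimitive_stdAddChar N)]
  simp only [sub_eq_zero, ZMod.card, Prod.mk.injEq]
  by_cases h4 : l = l'
  · by_cases h5 : m = m'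
    · rw [if_pos h4.symm, if_pos h5.symm, if_pos ⟨h4, h5⟩]
      field_simp
    · rw [if_neg (Ne.symm h5), if_neg (c := l = l' ∧ m = m') fun h => h5 h.2]
      simp
  · rw [if_neg (Ne.symm h4), if_neg (c := l = l' ∧ m = m') fun h => h4 h.1]
    simp

/-- The plane waves as an orthonormal basis. -/
def waveBasis (p N : ℕ) [NeZero p] [NeZero N] :
    OrthonormalBasis (ZMod p × ZMod N) ℂ (Fiber p N) :=
  OrthonormalBasis.mk orthonormal_planeWave (by
    refine (orthonormal_planeWave.linearIndependent.span_eq_top_of_card_eq_finrank ?_).ge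
    rw [finrank_euclideanSpace])

lemma waveBasis_apply (q : ZMod p × ZMod N) : waveBasis p N q = planeWave q := by
  simp [waveBasis]

/-- The symbol of the hopping operator. -/
def symbol (t : Fin 3 → ℤ × ZMod N) (q : ZMod p × ZMod N) : ℂ :=
  ∑ i, (ZMod.stdAddChar (((t i).1 : ZMod p) * q.1) : ℂ) * ZMod.stdAddChar ((t i).2 * q.2)

lemma hop_planeWave (t : Fin 3 → ℤ × ZMod N) (q : ZMod p × ZMod N) :
    hop t 0 (planeWave q : Fiber p N) = symbol t q • planeWave q := by
  ext x
  rw [hop_apply, PiLp.smul_apply, symbol, smul_eq_mul, Finset.sum_mul]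
  refine Finset.sum_congr rfl fun i _ => ?_
  rw [planeWave_apply, planeWave_apply]
  simp only [proj, Prod.fst_add, Prod.snd_add, add_mul, AddChar.map_add_eq_mul]
  simp
  ring

/-- A plane wave with nonzero angular momentum has zero mean around the tube and is an eigenvector
of `hop t 0`, so `norm_hop_le` applies to it. -/
lemma norm_symbol_le {t : Fin 3 → ℤ × ZMod N} (ht : GoodBonds t) {q : ZMod p × ZMod N}
    (hq : q.2 ≠ 0) : ‖symbol t q‖ ≤ 3 - loss N := by
  have h1 : ∀ n, ∑ k, (planeWave q : Fiber p N) (n, k) = 0 := by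
    intro n
    simp_rw [planeWave_apply, ← Finset.mul_sum]
    rw [AddChar.sum_mulShift _ (ZMod.isPrimitive_stdAddChar N), if_neg hq]
    simp
  have h2 := norm_hop_le ht 0 h1
  rw [hop_planeWave, norm_smul, orthonormal_planeWave.1 q] at h2
  simpa using h2

lemma norm_pot_le {V : ℤ → ℝ} {ε : ℝ} (hε : 0 ≤ ε) (hV : ∀ n, |V n| ≤ ε) (g : Fiber p N) :
    ‖pot V g‖ ≤ ε * ‖g‖ := by
  refine (sq_le_sq₀ (norm_nonneg _) (by positivity)).1 ?_
  rw [mul_pow, EuclideanSpace.norm_sq_eq, EuclideanSpace.norm_sq_eq, Finset.mul_sum]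
  refine Finset.sum_le_sum fun x _ => ?_
  rw [pot_apply, norm_mul, mul_pow, Complex.norm_real, Real.norm_eq_abs]
  gcongr
  exact hV _

lemma re_inner_pot_ge {V : ℤ → ℝ} {ε : ℝ} (hε : 0 ≤ ε) (hV : ∀ n, |V n| ≤ ε) (g : Fiber p N) :
    -ε * ‖g‖ ^ 2 ≤ (inner ℂ g (pot V g)).re := by
  have h1 := Complex.abs_re_le_norm (inner ℂ g (pot V g))
  have h2 := norm_inner_le_norm (𝕜 := ℂ) g (pot V g)
  have h3 := norm_pot_le hε hV g
  have h4 := neg_abs_le (inner ℂ g (pot V g)).re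
  nlinarith [norm_nonneg g]

lemma re_inner_bloch (t : Fin 3 → ℤ × ZMod N) (V₀ V₁ : ℤ → ℝ) (κ : ℝ)
    (x : WithLp 2 (Fiber p N × Fiber p N)) : (inner ℂ x (bloch t V₀ V₁ κ x)).re =
      2 * (inner ℂ x.fst (hop t κ x.snd)).re + (inner ℂ x.fst (pot V₀ x.fst)).re
        + (inner ℂ x.snd (pot V₁ x.snd)).re := by
  rw [WithLp.prod_inner_apply]
  change (inner ℂ x.fst (hop t κ x.snd + pot V₀ x.fst)
    + inner ℂ x.snd (hop (-t) κ x.fst + pot V₁ x.snd)).re = _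
  rw [inner_add_right, inner_add_right, ← inner_hop, ← inner_conj_symm (hop t κ x.snd)]
  simp only [Complex.add_re, Complex.conj_re]
  ring

/-- For small potentials, the number of gaps near the bottom of the spectrum is at most one more
than the number of plane waves there. -/
lemma encard_openGaps_tube_le {t : Fin 3 → ℤ × ZMod N} (ht : GoodBonds t)
    {T₀ : L2 (Vertex N) →L[ℂ] L2 (Vertex N)} (hT₀ : IsTube t 0 0 T₀) {α : ℝ} (hα : α < loss N) :
    ∃ ε : ℝ, 0 < ε ∧ ∀ (V₀ V₁ : ℤ → ℝ) (T : L2 (Vertex N) →L[ℂ] L2 (Vertex N)),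
      (∀ n, V₀ (n + p) = V₀ n) → (∀ n, V₁ (n + p) = V₁ n) → (∀ n, |V₀ n| ≤ ε) →
      (∀ n, |V₁ n| ≤ ε) → IsTube t V₀ V₁ T → (openGaps (realSpectrum T) (-3) (-3 + α)).encard ≤
        ((Nat.card {l : ZMod p // 3 - α ≤ ‖symbol t (l, 0)‖} + 1 : ℕ) : ℕ∞) := by
  classical
  -- There are finitely many symbols, so those of modulus below `3 - α` stay below some `c < 3 - α`.
  -- The room `3 - α - c` is the admissible size of the potential.
  have h1 : ∀ᶠ c in 𝓝[<] (3 - α), 0 < c ∧ c < 3 - α ∧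
      ∀ q : ZMod p × ZMod N, ‖symbol t q‖ < 3 - α → ‖symbol t q‖ < c := by
    refine ((lt_mem_nhds (by linarith [loss_le (N := N)])).filter_mono nhdsWithin_le_nhds).and
      (eventually_mem_nhdsWithin.and (eventually_all.2 fun q => ?_))
    by_cases h : ‖symbol t q‖ < 3 - α
    · filter_upwards [(lt_mem_nhds h).filter_mono nhdsWithin_le_nhds] with c hc _ using hc
    · exact Eventually.of_forall fun c h' => absurd h' h
  obtain ⟨c, hc0, hc, hcq⟩ := h1.exists
  refine ⟨3 - α - c, by linarith, fun V₀ V₁ T hV₀ hV₁ hb₀ hb₁ hT => ?_⟩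
  refine encard_openGaps_le (Q := {μ | ¬ NoEigen (bloch t V₀ V₁ 0 :
    WithLp 2 (Fiber p N × Fiber p N) →L[ℂ] _) μ}) ?_ ?_
  · intro E₁ E₂ s h₁ h₂ hs h₃ h₄
    exact exists_eigenvalue_between ht.abs_le hV₀ hV₁ hT hT₀ h₁ h₂ hs h₃ h₄
  · intro s hs
    rw [Nat.card_eq_fintype_card]
    -- One condition per plane wave is enough, although the two sublattices give it two dimensions:
    -- on the graph `x̂₀ = symbol · x̂₁` the hopping energy of the wave is nonnegative.
    let φ : {l : ZMod p // 3 - α ≤ ‖symbol t (l, 0)‖} →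
        WithLp 2 (Fiber p N × Fiber p N) →ₗ[ℂ] ℂ := fun l =>
      { toFun := fun x => inner ℂ (planeWave ((l : ZMod p), (0 : ZMod N))) x.fst
          - symbol t ((l : ZMod p), (0 : ZMod N)) *
            inner ℂ (planeWave ((l : ZMod p), (0 : ZMod N))) x.snd
        map_add' := fun x y => by
          rw [WithLp.add_fst, WithLp.add_snd, inner_add_right, inner_add_right]; ring
        map_smul' := fun a x => by
          rw [WithLp.smul_fst, WithLp.smul_snd, inner_smul_right, inner_smul_right,
            RingHom.id_apply, smul_eq_mul]; ring }
    refine card_eigenvalues_le (isSymmetric_bloch t V₀ V₁ 0) φ (fun x hx => ?_) s hs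
    have h2 := re_inner_ge_of_diagonal (waveBasis p N) (A := hop t 0) (a := symbol t)
      (fun q => by rw [waveBasis_apply]; exact hop_planeWave t q) hc0.le x.fst x.snd (by
        rintro ⟨l, m⟩
        rcases lt_or_ge ‖symbol t (l, m)‖ (3 - α) with h | h
        · exact Or.inl (hcq _ h).le
        · right
          -- Since `α < loss N`, no wave with nonzero angular momentum reaches `3 - α`.
          have hm : m = 0 := by
            by_contra hm
            have := norm_symbol_le ht (q := (l, m)) hm
            linarith
          subst hm
          rw [waveBasis_apply]
          exact sub_eq_zero.1 (hx ⟨l, h⟩))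
    rw [re_inner_bloch, WithLp.prod_norm_sq_eq_of_L2]
    have h3 := re_inner_pot_ge (by linarith) hb₀ x.fst
    have h4 := re_inner_pot_ge (by linarith) hb₁ x.snd
    linarith

end Nanotube

end

/-! ### The two tubes: self-adjointness, bonds, symbols and the count of plane waves. -/

noncomputable section

namespace Nanotube

section SelfAdjoint

variable {ι : Type}

lemma isSelfAdjoint_permOp {σ : Equiv.Perm ι} (hσ : Function.Involutive σ) :
    IsSelfAdjoint (permOp σ) := by
  rw [ContinuousLinearMap.isSelfAdjoint_iff_isSymmetric]
  intro f g
  simp only [ContinuousLinearMap.coe_coe, lp.inner_eq_tsum, permOp_apply]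
  rw [← Equiv.tsum_eq σ fun i => inner ℂ (f i) (g (σ i))]
  simp [hσ _]

lemma isSelfAdjoint_diagOp (v : BddSeq) (c : ι → ℤ) : IsSelfAdjoint (diagOp v c) := by
  rw [ContinuousLinearMap.isSelfAdjoint_iff_isSymmetric]
  intro f g
  simp only [ContinuousLinearMap.coe_coe, lp.inner_eq_tsum, diagOp_apply]
  refine tsum_congr fun i => ?_
  simp [mul_left_comm, mul_assoc]

lemma isSelfAdjoint_bond {N : ℕ} (s : ℤ) (t : ZMod N) : IsSelfAdjoint (permOp (bond N s t)) :=
  isSelfAdjoint_permOp (Function.Involutive.toPerm_involutive _)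

end SelfAdjoint

variable {N : ℕ}

/-- The bonds of the armchair tube. -/
def armchairBonds (N : ℕ) : Fin 3 → ℤ × ZMod N := ![(1, 0), (-1, -1), (0, 0)]

/-- The bonds of the zigzag tube. -/
def zigzagBonds (N : ℕ) : Fin 3 → ℤ × ZMod N := ![(-1, 0), (-1, -1), (0, 0)]

lemma isTube_armchair (v : BddSeq) : IsTube (armchairBonds N) (fun n => v (2 * n))
    (fun n => v (2 * n + 1)) (armchairHamiltonian N v) where
  selfAdjoint := (((isSelfAdjoint_bond _ _).add (isSelfAdjoint_bond _ _)).add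
    (isSelfAdjoint_bond _ _)).add (isSelfAdjoint_diagOp _ _)
  apply_eq := by
    rintro f ⟨n, j, k⟩
    fin_cases j
    · simp only [Fin.zero_eta, tubeFun_zero, armchairHamiltonian_apply_zero, Fin.sum_univ_three]
      simp [armchairBonds, sub_eq_add_neg]
    · simp only [Fin.mk_one, tubeFun_one, armchairHamiltonian_apply_one, Fin.sum_univ_three]
      simp [armchairBonds]

lemma isTube_zigzag (v : BddSeq) : IsTube (zigzagBonds N) (fun n => v (2 * n + 1))
    (fun n => v (2 * (n + 1))) (zigzagHamiltonian N v) where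
  selfAdjoint := (((isSelfAdjoint_bond _ _).add (isSelfAdjoint_bond _ _)).add
    (isSelfAdjoint_bond _ _)).add (isSelfAdjoint_diagOp _ _)
  apply_eq := by
    rintro f ⟨n, j, k⟩
    fin_cases j
    · simp only [Fin.zero_eta, tubeFun_zero, zigzagHamiltonian_apply_zero, Fin.sum_univ_three]
      simp [zigzagBonds, sub_eq_add_neg]
    · simp only [Fin.mk_one, tubeFun_one, zigzagHamiltonian_apply_one, Fin.sum_univ_three]
      simp [zigzagBonds]

lemma isTube_armchair_zero : IsTube (armchairBonds N) 0 0 (armchairHamiltonian N 0) :=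
  isTube_armchair 0

lemma isTube_zigzag_zero : IsTube (zigzagBonds N) 0 0 (zigzagHamiltonian N 0) :=
  isTube_zigzag 0

section Good

variable [NeZero N]

/-- The axial displacements of the bonds `(1, 0)` and `(-1, -1)` cancel and their composition is the
rotation by `(0, -1)`; so a function nearly fixed by both is nearly rotation invariant. -/
lemma goodBonds_armchair : GoodBonds (armchairBonds N) where
  abs_le := by
    intro i
    fin_cases i <;> simp [armchairBonds]
  spread := by
    intro p _ κ g
    change _ ≤ 2 * (‖twist κ (1, 0) g - twist κ (-1, -1) g‖ ^ 2
      + ‖twist κ (-1, -1) g - twist κ 0 g‖ ^ 2 + ‖twist κ (1, 0) g - twist κ 0 g‖ ^ 2)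
    rw [twist_zero]
    have h1 : twist κ (-1, -1) g - shift (0, -1) g
        = twist κ (-1, -1) (g - twist κ (1, 0) g) := by
      rw [map_sub, twist_twist, ← twist_zero_left κ]
      simp
    have h2 : ‖g - shift (0, -1) g‖ ≤
        ‖twist κ (-1, -1) g - g‖ + ‖twist κ (1, 0) g - g‖ := by
      rw [norm_sub_rev _ g, norm_sub_rev _ g, ← norm_twist κ (-1, -1) (g - twist κ (1, 0) g), ← h1]
      exact norm_sub_le_norm_sub_add_norm_sub _ _ _
    nlinarith [norm_nonneg (g - shift (0, -1) g), sq_nonneg (‖twist κ (-1, -1) g - g‖ -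
      ‖twist κ (1, 0) g - g‖), sq_nonneg ‖twist κ (1, 0) g - twist κ (-1, -1) g‖]

/-- The bonds `(-1, 0)` and `(-1, -1)` differ by the rotation itself. -/
lemma goodBonds_zigzag : GoodBonds (zigzagBonds N) where
  abs_le := by
    intro i
    fin_cases i <;> simp [zigzagBonds]
  spread := by
    intro p _ κ g
    change _ ≤ 2 * (‖twist κ (-1, 0) g - twist κ (-1, -1) g‖ ^ 2
      + ‖twist κ (-1, -1) g - twist κ 0 g‖ ^ 2 + ‖twist κ (-1, 0) g - twist κ 0 g‖ ^ 2)
    have h1 : twist κ (-1, 0) g - twist κ (-1, -1) g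
        = twist κ (-1, 0) (g - shift (0, -1) g) := by
      rw [map_sub, ← twist_zero_left κ, twist_twist]
      simp
    rw [h1, norm_twist]
    nlinarith [sq_nonneg ‖g - shift (0, -1) g‖, sq_nonneg ‖twist κ (-1, -1) g - twist κ 0 g‖,
      sq_nonneg ‖twist κ (-1, 0) g - twist κ 0 g‖]

end Good

section Symbol

variable {p : ℕ} [NeZero p] [NeZero N]

lemma stdAddChar_eq_exp (l : ZMod p) : (ZMod.stdAddChar l : ℂ) =
    Complex.exp ((2 * Real.pi * l.val / p : ℝ) * Complex.I) := by
  have h := ZMod.stdAddChar_coe (N := p) (l.val : ℤ)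
  rw [Int.cast_natCast, ZMod.natCast_zmod_val] at h
  rw [h]
  congr 1
  push_cast
  ring

lemma symbol_armchair (l : ZMod p) : symbol (armchairBonds N) (l, (0 : ZMod N)) =
    ((1 + 2 * Real.cos (2 * Real.pi * l.val / p) : ℝ) : ℂ) := by
  have h : (ZMod.stdAddChar (-l) : ℂ) =
      Complex.exp (-(2 * Real.pi * l.val / p : ℝ) * Complex.I) := by
    rw [AddChar.map_neg_eq_conj, stdAddChar_eq_exp, ← Complex.exp_conj, map_mul,
      Complex.conj_ofReal, Complex.conj_I, mul_neg, neg_mul]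
  simp only [symbol, armchairBonds, Fin.sum_univ_three]
  simp only [Matrix.cons_val_zero, Matrix.cons_val_one, Matrix.cons_val, Int.cast_one, one_mul,
    mul_zero, AddChar.map_zero_eq_one, mul_one, Int.cast_neg, neg_mul, Int.cast_zero, zero_mul]
  rw [h, stdAddChar_eq_exp, Complex.ofReal_add, Complex.ofReal_mul, Complex.ofReal_cos,
    Complex.ofReal_ofNat, Complex.two_cos, Complex.ofReal_one]
  ring

lemma symbol_zigzag (l : ZMod p) : symbol (zigzagBonds N) (l, (0 : ZMod N)) =
    1 + 2 * starRingEnd ℂ (ZMod.stdAddChar l) := by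
  simp only [symbol, zigzagBonds, Fin.sum_univ_three]
  simp only [Matrix.cons_val_zero, Matrix.cons_val_one, Matrix.cons_val, Int.cast_neg, Int.cast_one,
    neg_mul, one_mul, mul_zero, AddChar.map_zero_eq_one, mul_one, Int.cast_zero, zero_mul,
    AddChar.map_neg_eq_conj]
  ring

lemma norm_sq_symbol_zigzag (l : ZMod p) : ‖symbol (zigzagBonds N) (l, (0 : ZMod N))‖ ^ 2 =
    5 + 4 * Real.cos (2 * Real.pi * l.val / p) := by
  rw [symbol_zigzag, stdAddChar_eq_exp, ← Complex.normSq_eq_norm_sq, Complex.normSq_apply]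
  set x := 2 * Real.pi * l.val / p
  simp only [Complex.add_re, Complex.one_re, Complex.mul_re, Complex.re_ofNat, Complex.conj_re,
    Complex.exp_ofReal_mul_I_re, Complex.im_ofNat, Complex.conj_im, Complex.exp_ofReal_mul_I_im,
    Complex.add_im, Complex.one_im, Complex.mul_im]
  nlinarith [Real.sin_sq_add_cos_sq x]

/-- Since `cos` is symmetric about `π`, either `l` or `p - l` is at most `pφ/(2π)`, where `φ =
arccos c`. Each case leaves at most `⌊pφ/(2π)⌋ + 1` values. -/
lemma natCard_cos_ge_le {c : ℝ} (hc : -1 ≤ c) (hc' : c ≤ 1) :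
    (Nat.card {l : ZMod p // c ≤ Real.cos (2 * Real.pi * l.val / p)} : ℝ) ≤
      p / Real.pi * Real.arccos c + 2 := by
  classical
  have hp : (0 : ℝ) < p := by exact_mod_cast NeZero.pos p
  set φ := Real.arccos c with hφ
  have hφ0 : 0 ≤ φ := Real.arccos_nonneg c
  have hφπ : φ ≤ Real.pi := Real.arccos_le_pi c
  have hπ := Real.pi_pos
  set K := ⌊p * φ / (2 * Real.pi)⌋₊ with hK
  have hcos : ∀ x, 0 ≤ x → x ≤ Real.pi → c ≤ Real.cos x → x ≤ φ := by
    intro x h0 h1 h2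
    by_contra h
    push Not at h
    have := Real.cos_lt_cos_of_nonneg_of_le_pi hφ0 h1 h
    rw [hφ, Real.cos_arccos hc hc'] at this
    linarith
  have hfl : ∀ m : ℕ, 2 * Real.pi * m / p ≤ φ → m ≤ K := by
    intro m hm
    refine Nat.le_floor ?_
    rw [div_le_iff₀ hp] at hm
    rw [le_div_iff₀ (by positivity)]
    linarith
  have hmem : ∀ l : ZMod p, c ≤ Real.cos (2 * Real.pi * l.val / p) →
      l.val ∈ Finset.range (K + 1) ∪ (Finset.range (K + 1)).image (p - ·) := by
    intro l hl
    have hlp : l.val < p := ZMod.val_lt l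
    have hlp' : (l.val : ℝ) < p := by exact_mod_cast hlp
    rw [Finset.mem_union]
    rcases le_total (2 * Real.pi * l.val / p) Real.pi with h | h
    · left
      rw [Finset.mem_range, Nat.lt_succ_iff]
      exact hfl _ (hcos _ (by positivity) h hl)
    · right
      rw [Finset.mem_image]
      refine ⟨p - l.val, ?_, by omega⟩
      rw [Finset.mem_range, Nat.lt_succ_iff]
      apply hfl
      have h1 : 2 * Real.pi * ((p - l.val : ℕ) : ℝ) / p =
          2 * Real.pi - 2 * Real.pi * l.val / p := by
        rw [Nat.cast_sub hlp.le]
        field_simp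
      rw [h1]
      refine hcos _ ?_ (by linarith) (by rwa [Real.cos_two_pi_sub])
      rw [sub_nonneg, div_le_iff₀ hp]
      nlinarith
  have hcard : Nat.card {l : ZMod p // c ≤ Real.cos (2 * Real.pi * l.val / p)} ≤
      2 * (K + 1) := by
    rw [Nat.card_eq_fintype_card, Fintype.card_subtype]
    have h1 := Finset.card_le_card_of_injOn (s := Finset.univ.filter fun l : ZMod p =>
      c ≤ Real.cos (2 * Real.pi * l.val / p)) ZMod.val (fun l hl => hmem l (by simpa using hl))
      (fun l _ l' _ h => ZMod.val_injective p h)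
    refine h1.trans ((Finset.card_union_le _ _).trans ?_)
    have := (Finset.card_image_le (s := Finset.range (K + 1)) (f := (p - ·)))
    rw [Finset.card_range] at this ⊢
    omega
  have hKle : (K : ℝ) ≤ p * φ / (2 * Real.pi) := Nat.floor_le (by positivity)
  have h2 : ((Nat.card {l : ZMod p // c ≤ Real.cos (2 * Real.pi * l.val / p)} : ℕ) : ℝ) ≤
      ((2 * (K + 1) : ℕ) : ℝ) := by exact_mod_cast hcard
  refine h2.trans ?_
  push_cast
  have h3 : p * φ / (2 * Real.pi) * 2 = p / Real.pi * φ := by field_simp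
  linarith

end Symbol

end Nanotube

end

/-! ### The Kronig–Penney recurrence and the reduction to one dimension. -/

noncomputable section

namespace Nanotube

section Recurrence

/-- The free solution through `u 0`, `u 1`, multiplied by `sin θ` to avoid division. The recurrence
is assumed only strictly between `0` and `p`, where the comb vanishes; the second conjunct carries
the two-step induction. -/
lemma sin_mul_eq_of_recurrence {θ : ℝ} {u : ℕ → ℂ} {p : ℕ}
    (h : ∀ n, n + 1 < p → u (n + 2) + u n = 2 * Real.cos θ * u (n + 1)) :
    ∀ n, n < p →
      Real.sin θ * u (n + 1) = u 1 * Real.sin ((n + 1 : ℕ) * θ) - u 0 * Real.sin (n * θ) ∧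
      Real.sin θ * u n = u 1 * Real.sin (n * θ) - u 0 * Real.sin (n * θ - θ) := by
  intro n
  induction n with
  | zero =>
    intro _
    constructor
    · simp [mul_comm]
    · simp [mul_comm]
  | succ n ih =>
    intro hn
    obtain ⟨h1, h2⟩ := ih (by omega)
    refine ⟨?_, ?_⟩
    · have h3 : Real.sin ((n + 1 + 1 : ℕ) * θ) =
          2 * Real.cos θ * Real.sin ((n + 1 : ℕ) * θ) - Real.sin (n * θ) := by
        have e1 : ((n + 1 + 1 : ℕ) : ℝ) * θ = (n + 1 : ℕ) * θ + θ := by push_cast; ring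
        have e2 : (n : ℝ) * θ = (n + 1 : ℕ) * θ - θ := by push_cast; ring
        rw [e1, e2, Real.sin_add, Real.sin_sub]; ring
      have h4 : Real.sin ((n + 1 : ℕ) * θ) =
          2 * Real.cos θ * Real.sin (n * θ) - Real.sin (n * θ - θ) := by
        have e1 : ((n + 1 : ℕ) : ℝ) * θ = n * θ + θ := by push_cast; ring
        rw [e1, Real.sin_add, Real.sin_sub]; ring
      have h5 : u (n + 1 + 1) = 2 * Real.cos θ * u (n + 1) - u n := by rw [← h n hn]; ring
      rw [h5, h3, mul_sub, mul_left_comm, h1, h2]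
      rw [h4]
      push_cast
      ring
    · rw [h1]
      congr 3
      push_cast
      ring_nf

/-- A quasiperiodic solution of the Kronig–Penney recurrence vanishes if the discriminant exceeds
`2` in absolute value. -/
lemma eq_zero_of_kronigPenney {p : ℕ} (hp : 1 ≤ p) {θ w : ℝ} {u : ℤ → ℂ} {ζ : ℂ} (hζ : ‖ζ‖ = 1)
    (hu : ∀ n, u (n + p) = ζ * u n)
    (hrec : ∀ n, u (n + 1) + u (n - 1) =
      ((2 * Real.cos θ + if (p : ℤ) ∣ n then w else 0 : ℝ) : ℂ) * u n)
    (hs : Real.sin (p * θ) ≠ 0)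
    (hD : 2 < |2 * Real.cos (p * θ) + w * (Real.sin (p * θ) / Real.sin θ)|) : ∀ n, u n = 0 := by
  have hsθ : Real.sin θ ≠ 0 := by
    intro h0
    obtain ⟨k, hk⟩ := Real.sin_eq_zero_iff.1 h0
    apply hs
    rw [← hk, ← mul_assoc]
    have := Real.sin_int_mul_pi (p * k)
    push_cast at this
    exact this
  have hndvd : ∀ n : ℕ, n + 1 < p → ¬ (p : ℤ) ∣ ((n : ℤ) + 1) := by
    intro n hn h
    have := Int.le_of_dvd (by omega) h
    omega
  -- The free solution is run from `0` to `p`, and by reflection from `0` to `-p`; neither run uses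
  -- the recurrence at a multiple of `p`.
  have hf := (sin_mul_eq_of_recurrence (θ := θ) (u := fun n : ℕ => u n) (p := p) (fun n hn => by
    have := hrec (n + 1)
    rw [if_neg (hndvd n hn), add_zero] at this
    push_cast at this ⊢
    rw [← this]
    congr 2; ring) (p - 1) (by omega)).1
  have hb := (sin_mul_eq_of_recurrence (θ := θ) (u := fun n : ℕ => u (-n)) (p := p) (fun n hn => by
    have := hrec (-(n + 1))
    rw [if_neg (by rw [Int.dvd_neg]; exact hndvd n hn), add_zero] at this
    push_cast at this ⊢
    rw [← this, add_comm]
    congr 2; ring) (p - 1) (by omega)).1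
  have e1 : ((p - 1 : ℕ) : ℝ) * θ = p * θ - θ := by rw [Nat.cast_sub hp]; push_cast; ring
  rw [Nat.sub_add_cancel hp, e1, Real.sin_sub] at hf hb
  have hup : u p = ζ * u 0 := by simpa using hu 0
  have hum : u (-p) = starRingEnd ℂ ζ * u 0 := by
    have h1 := hu (-p)
    rw [neg_add_cancel] at h1
    rw [h1, ← mul_assoc, Complex.conj_mul', hζ]
    simp
  have h0 := hrec 0
  rw [if_pos (dvd_zero _)] at h0
  simp only [Nat.cast_one, Nat.cast_zero, neg_zero, zero_add, zero_sub] at hf hb h0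
  set S := Real.sin (p * θ) with hS
  set C := Real.cos (p * θ) with hC
  have hu0 : u 0 = 0 := by
    by_contra hne
    have h1 : (Real.sin θ : ℂ) * (ζ + starRingEnd ℂ ζ) = w * S + 2 * C * Real.sin θ := by
      apply mul_right_cancel₀ hne
      have h2 : (Real.sin θ : ℂ) * (ζ + starRingEnd ℂ ζ) * u 0 =
          Real.sin θ * u p + Real.sin θ * u (-p) := by rw [hup, hum]; ring
      rw [h2, hf, hb]
      have h3 : (u 1 + u (-1)) * S = (2 * Real.cos θ + w) * u 0 * S := by
        rw [h0, Complex.ofReal_add, Complex.ofReal_mul, Complex.ofReal_ofNat]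
      simp only [Complex.ofReal_sub, Complex.ofReal_mul]
      linear_combination h3
    rw [Complex.add_conj] at h1
    have h2 : Real.sin θ * (2 * ζ.re) = w * S + 2 * C * Real.sin θ := by exact_mod_cast h1
    have h3 : 2 * C + w * (S / Real.sin θ) = 2 * ζ.re := by
      field_simp
      linarith
    rw [h3, abs_mul, abs_two] at hD
    have := Complex.abs_re_le_norm ζ
    rw [hζ] at this
    linarith
  have hu1 : u 1 = 0 := by
    rw [hup, hu0] at hf
    have : u 1 * (S : ℂ) = 0 := by simpa using hf.symm
    have hS' : (S : ℂ) ≠ 0 := by exact_mod_cast hs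
    simpa [hS'] using this
  have hall : ∀ n : ℤ, u n = 0 ∧ u (n + 1) = 0 := by
    intro n
    induction n using Int.induction_on with
    | zero => exact ⟨hu0, by simpa using hu1⟩
    | succ n ih =>
      refine ⟨ih.2, ?_⟩
      have := hrec (n + 1)
      rw [ih.2, add_sub_cancel_right, ih.1] at this
      simpa using this
    | pred n ih =>
      refine ⟨?_, by rw [sub_add_cancel]; exact ih.1⟩
      have := hrec (-n)
      rw [ih.1, ih.2] at this
      simpa using this
  exact fun n => (hall n).1

/-- The recurrence improves any uniform bound on `u` by the factor `2/3`. -/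
lemma eq_zero_of_contraction {u : ℤ → ℂ} {C : ℝ} (hC : ∀ n, ‖u n‖ ≤ C) {q : ℤ → ℝ}
    (hq : ∀ n, 3 ≤ |q n|) (hrec : ∀ n, u (n + 1) + u (n - 1) = q n * u n) (n : ℤ) : u n = 0 := by
  have h : ∀ k : ℕ, ∀ n, ‖u n‖ ≤ (2 / 3) ^ k * C := by
    intro k
    induction k with
    | zero => simpa using hC
    | succ k ih =>
      intro n
      have h1 : ‖(q n : ℂ) * u n‖ ≤ (2 / 3) ^ k * C + (2 / 3) ^ k * C := by
        rw [← hrec]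
        exact (norm_add_le _ _).trans (add_le_add (ih _) (ih _))
      rw [norm_mul, Complex.norm_real, Real.norm_eq_abs] at h1
      have h2 : 3 * ‖u n‖ ≤ |q n| * ‖u n‖ := mul_le_mul_of_nonneg_right (hq n) (norm_nonneg _)
      rw [pow_succ]
      linarith
  have h1 : Tendsto (fun k : ℕ => (2 / 3 : ℝ) ^ k * C) atTop (𝓝 (0 * C)) :=
    (tendsto_pow_atTop_nhds_zero_of_lt_one (by norm_num) (by norm_num)).mul_const C
  have h2 := ge_of_tendsto' h1 fun k => h k n
  rw [zero_mul] at h2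
  simpa using h2

end Recurrence

section Reduction

/-- The form is at least `-(c + ε)(a² + b²)`, which a nonzero vector of energy `E < -c - ε` would
violate. Here `a`, `b` are the norms on the two sublattices. -/
lemma eq_zero_of_energy_lt {a b c r v w ε E : ℝ} (hc : 0 ≤ c)
    (h : E * (a ^ 2 + b ^ 2) = 2 * r + v + w) (hv : -ε * a ^ 2 ≤ v) (hw : -ε * b ^ 2 ≤ w)
    (hr : -(c * (a * b)) ≤ r) (hE : E + ε < -c) : a = 0 ∧ b = 0 := by
  have h1 : c * (2 * (a * b)) ≤ c * (a ^ 2 + b ^ 2) :=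
    mul_le_mul_of_nonneg_left (by nlinarith [sq_nonneg (a - b)]) hc
  have h2 : a ^ 2 + b ^ 2 ≤ 0 := by
    by_contra hn
    push Not at hn
    have := mul_lt_mul_of_pos_right hE hn
    linarith
  constructor <;> nlinarith [sq_nonneg a, sq_nonneg b]

variable {p N : ℕ} [NeZero p] [NeZero N]

/-- At low energies, the eigenvectors of the Bloch Hamiltonians are constant around the tube. -/
lemma shift_eq_of_bloch_eigen {t : Fin 3 → ℤ × ZMod N} (ht : GoodBonds t) {V₀ V₁ : ℤ → ℝ} {ε E : ℝ}
    (hε : 0 ≤ ε) (hb₀ : ∀ n, |V₀ n| ≤ ε) (hb₁ : ∀ n, |V₁ n| ≤ ε) (hE : E + ε < -3 + loss N) {κ : ℝ}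
    {x : WithLp 2 (Fiber p N × Fiber p N)} (hx : bloch t V₀ V₁ κ x = (E : ℂ) • x) :
    shift (0, -1) x.fst = x.fst ∧ shift (0, -1) x.snd = x.snd := by
  have hx0 : hop t κ x.snd + pot V₀ x.fst = (E : ℂ) • x.fst := congrArg WithLp.fst hx
  have hx1 : hop (-t) κ x.fst + pot V₁ x.snd = (E : ℂ) • x.snd := congrArg WithLp.snd hx
  have hhop : ∀ (s : Fin 3 → ℤ × ZMod N) (g : Fiber p N),
      hop s κ (shift (0, -1) g) = shift (0, -1) (hop s κ g) := by
    intro s g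
    simp only [hop, FunLike.coe_sum, Finset.sum_apply, map_sum, smul_apply, map_smul, shift_shift]
    exact Finset.sum_congr rfl fun i _ => by rw [add_comm]
  have hpot : ∀ (V : ℤ → ℝ) (g : Fiber p N), pot V (shift (0, -1) g) = shift (0, -1) (pot V g) := by
    intro V g
    ext y
    simp
  -- The Hamiltonian commutes with rotations, so `x` minus its rotation satisfies the same
  -- eigenvalue equation. It has zero mean around the tube, so its hopping energy is too weak for
  -- the energy `E` and it vanishes.
  set y : WithLp 2 (Fiber p N × Fiber p N) :=
    WithLp.toLp 2 (x.fst - shift (0, -1) x.fst, x.snd - shift (0, -1) x.snd) with hy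
  have hyf : y.fst = x.fst - shift (0, -1) x.fst := rfl
  have hys : y.snd = x.snd - shift (0, -1) x.snd := rfl
  have hmean : ∀ (g : Fiber p N) n, ∑ k, (g - shift (0, -1) g) (n, k) = 0 := by
    intro g n
    simp only [PiLp.sub_apply, shift_apply, Finset.sum_sub_distrib, sub_eq_zero, Prod.mk_add_mk,
      add_zero]
    exact (Fintype.sum_equiv (Equiv.addRight (-1)) _ _ fun k => rfl).symm
  have hye : bloch t V₀ V₁ κ y = (E : ℂ) • y := by
    refine WithLp.ofLp_injective 2 (Prod.ext ?_ ?_)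
    · change hop t κ y.snd + pot V₀ y.fst = (E : ℂ) • y.fst
      rw [hyf, hys, map_sub, map_sub, hhop, hpot, smul_sub, ← map_smul, ← hx0, map_add]
      abel
    · change hop (-t) κ y.fst + pot V₁ y.snd = (E : ℂ) • y.snd
      rw [hyf, hys, map_sub, map_sub, hhop, hpot, smul_sub, ← map_smul, ← hx1, map_add]
      abel
  have h1 := re_inner_bloch t V₀ V₁ κ y
  rw [hye, inner_smul_right, inner_self_eq_ofReal_norm_sq, ← Complex.ofReal_mul, Complex.ofReal_re,
    WithLp.prod_norm_sq_eq_of_L2] at h1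
  have h2 := re_inner_pot_ge hε hb₀ y.fst
  have h3 := re_inner_pot_ge hε hb₁ y.snd
  have h4 : ‖hop t κ y.snd‖ ≤ (3 - loss N) * ‖y.snd‖ := norm_hop_le ht κ (hmean x.snd)
  have h5 := (neg_abs_le _).trans' (neg_le_neg ((Complex.abs_re_le_norm _).trans
    (norm_inner_le_norm (𝕜 := ℂ) y.fst (hop t κ y.snd))))
  have h6 : ‖y.fst‖ * ‖hop t κ y.snd‖ ≤ (3 - loss N) * (‖y.fst‖ * ‖y.snd‖) := by
    rw [mul_left_comm]
    exact mul_le_mul_of_nonneg_left h4 (norm_nonneg _)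
  obtain ⟨h10, h11⟩ := eq_zero_of_energy_lt (by linarith [loss_le (N := N)]) h1 h2 h3
    ((neg_le_neg h6).trans h5) (by linarith)
  rw [norm_eq_zero, hyf, sub_eq_zero] at h10
  rw [norm_eq_zero, hys, sub_eq_zero] at h11
  exact ⟨h10.symm, h11.symm⟩

lemma eq_of_shift_eq {g : Fiber p N} (hg : shift (0, -1) g = g) (n : ZMod p) (k : ZMod N) :
    g (n, k) = g (n, 0) := by
  have h : ∀ j : ℕ, g (n, (j : ZMod N)) = g (n, 0) := by
    intro j
    induction j with
    | zero => simp
    | succ j ih =>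
      rw [← ih]
      conv_lhs => rw [← hg, shift_apply]
      exact congrArg g (Prod.ext (by simp) (by simp))
  have := h k.val
  rwa [ZMod.natCast_zmod_val] at this

/-- At low energies, the spectrum is that of the one-dimensional operator on functions that are
constant around the tube. -/
lemma exists_bloch_solution {t : Fin 3 → ℤ × ZMod N} (ht : GoodBonds t) {V₀ V₁ : ℤ → ℝ}
    (hV₀ : ∀ n, V₀ (n + p) = V₀ n) (hV₁ : ∀ n, V₁ (n + p) = V₁ n)
    {T : L2 (Vertex N) →L[ℂ] L2 (Vertex N)} (hT : IsTube t V₀ V₁ T) {ε E : ℝ}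
    (hε : 0 ≤ ε) (hb₀ : ∀ n, |V₀ n| ≤ ε) (hb₁ : ∀ n, |V₁ n| ≤ ε) (hE : E + ε < -3 + loss N)
    (hET : E ∈ realSpectrum T) :
    ∃ (ζ : ℂ) (C : ℝ) (A B : ℤ → ℂ), ‖ζ‖ = 1 ∧ (∀ n, A (n + p) = ζ * A n) ∧
      (∀ n, B (n + p) = ζ * B n) ∧ (∀ n, ‖A n‖ ≤ C) ∧ (∀ n, ‖B n‖ ≤ C) ∧
      (∀ n, ∑ i, B (n + (t i).1) + V₀ n * A n = E * A n) ∧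
      (∀ n, ∑ i, A (n - (t i).1) + V₁ n * B n = E * B n) ∧ ¬ ((∀ n, A n = 0) ∧ ∀ n, B n = 0) := by
  by_contra hc
  refine notMem_realSpectrum (p := p) ht.abs_le hV₀ hV₁ hT (fun κ x hx => ?_) hET
  by_contra hx0
  apply hc
  obtain ⟨h1, h2⟩ := shift_eq_of_bloch_eigen ht hε hb₀ hb₁ hE hx
  have hf : tubeFun t V₀ V₁ (unfold κ x) = fun ω => E * unfold κ x ω := by
    rw [tubeFun_unfold t hV₀ hV₁, hx]
    funext ω
    simp only [unfold]
    split_ifs <;> simp [mul_left_comm]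
  have hk0 : ∀ n k, unfold κ x (n, 0, k) = unfold κ x (n, 0, 0) := by
    intro n k
    simp only [unfold, if_true]
    rw [eq_of_shift_eq h1]
  have hk1 : ∀ n k, unfold κ x (n, 1, k) = unfold κ x (n, 1, 0) := by
    intro n k
    simp only [unfold, Fin.isValue, one_ne_zero, if_false]
    rw [eq_of_shift_eq h2]
  have hexp : ∀ y : ℝ, ‖Complex.exp (y * Complex.I)‖ = 1 := Complex.norm_exp_ofReal_mul_I
  refine ⟨Complex.exp ((κ * p : ℝ) * Complex.I), ‖x.fst‖ + ‖x.snd‖, fun n => unfold κ x (n, 0, 0),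
    fun n => unfold κ x (n, 1, 0), hexp _, ?_, ?_, ?_, ?_, ?_, ?_, ?_⟩
  · intro n
    simp only [unfold, if_true]
    rw [← mul_assoc, ← Complex.exp_add]
    congr 1
    · congr 1; push_cast; ring
    · simp
  · intro n
    simp only [unfold, Fin.isValue, one_ne_zero, if_false]
    rw [← mul_assoc, ← Complex.exp_add]
    congr 1
    · congr 1; push_cast; ring
    · simp
  · intro n
    simp only [unfold, if_true]
    rw [norm_mul, show (κ : ℂ) * n * Complex.I = ((κ * n : ℝ) : ℂ) * Complex.I by push_cast; rfl,
      hexp, one_mul]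
    exact (PiLp.norm_apply_le x.fst _).trans (by linarith [norm_nonneg x.snd])
  · intro n
    simp only [unfold, Fin.isValue, one_ne_zero, if_false]
    rw [norm_mul, show (κ : ℂ) * n * Complex.I = ((κ * n : ℝ) : ℂ) * Complex.I by push_cast; rfl,
      hexp, one_mul]
    exact (PiLp.norm_apply_le x.snd _).trans (by linarith [norm_nonneg x.fst])
  · intro n
    have h3 := congrFun hf (n, 0, 0)
    rw [tubeFun_zero] at h3
    simpa only [hk1 _ (_ + _)] using h3
  · intro n
    have h3 := congrFun hf (n, 1, 0)
    rw [tubeFun_one] at h3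
    simpa only [hk0 _ (_ - _)] using h3
  · rintro ⟨hA, hB⟩
    apply hx0
    refine WithLp.ofLp_injective 2 (Prod.ext ?_ ?_)
    · ext y
      have h3 := hA (y.1.val : ℤ)
      simp only [unfold, if_true, mul_eq_zero, Complex.exp_ne_zero, false_or] at h3
      rw [Int.cast_natCast, ZMod.natCast_zmod_val, ← eq_of_shift_eq h1 _ y.2] at h3
      exact h3
    · ext y
      have h3 := hB (y.1.val : ℤ)
      simp only [unfold, Fin.isValue, one_ne_zero, if_false, mul_eq_zero, Complex.exp_ne_zero,
        false_or] at h3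
      rw [Int.cast_natCast, ZMod.natCast_zmod_val, ← eq_of_shift_eq h2 _ y.2] at h3
      exact h3

end Reduction

end Nanotube

end

/-! ### Lower bound: comb potentials that open the gaps. -/

noncomputable section

namespace Nanotube

/-- The sequence with value `ε` on `P` and `0` elsewhere. -/
def combSeq (P : Set ℤ) (ε : ℝ) : BddSeq :=
  ⟨P.indicator fun _ => ε, memℓp_infty ⟨|ε|, by
    rintro _ ⟨n, rfl⟩
    by_cases h : n ∈ P <;> simp [h]⟩⟩

lemma combSeq_apply (P : Set ℤ) (ε : ℝ) (n : ℤ) : combSeq P ε n = P.indicator (fun _ => ε) n := rfl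

lemma norm_combSeq_le (P : Set ℤ) {ε : ℝ} (hε : 0 ≤ ε) : ‖combSeq P ε‖ ≤ ε := by
  refine lp.norm_le_of_forall_le hε fun n => ?_
  rw [combSeq_apply]
  by_cases h : n ∈ P <;> simp [h, abs_of_nonneg hε, hε]

lemma abs_apply_le_norm (v : BddSeq) (n : ℤ) : |v n| ≤ ‖v‖ :=
  lp.norm_apply_le_norm (by simp) v n

/-- For small `δ`, `2 cos δ` loses at most `δ²`, while `ε sin δ` gains almost `εδ ≥ 2δ²`. -/
lemma exists_angle {ε : ℝ} (hε : 0 < ε) :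
    ∃ δ, 0 < δ ∧ δ < Real.pi ∧ 2 < 2 * Real.cos δ + ε * Real.sin δ := by
  have h0 : 0 < min 1 (ε / 2) := lt_min one_pos (by linarith)
  refine ⟨min 1 (ε / 2), h0, (min_le_left _ _).trans_lt (by linarith [Real.pi_gt_three]), ?_⟩
  set δ := min 1 (ε / 2)
  have h1 : δ ≤ 1 := min_le_left _ _
  have h2 : δ ≤ ε / 2 := min_le_right _ _
  have h3 := Real.one_sub_sq_div_two_le_cos (x := δ)
  have h4 := Real.sin_gt_sub_cube h0
  have h5 : δ - δ ^ 3 / 6 ≥ 3 / 4 * δ := by nlinarith [mul_pos h0 h0]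
  nlinarith [mul_pos hε h0]

/-- Lower bound for the number of gaps of a Kronig–Penney type spectrum, in terms of the dispersion
relation `e`. -/
lemma le_encard_openGaps_of_dispersion {S : Set ℝ} (hS : IsClosed S) {e : ℝ → ℝ} {φ α : ℝ}
    (hφ0 : 0 ≤ φ) (hφ : φ < Real.pi) (he : StrictMonoOn e (Icc 0 Real.pi)) (he0 : e 0 = -3)
    (heφ : e φ = -3 + α) {p : ℕ} (hp : 1 ≤ p) {ε : ℝ} (hε : 0 < ε)
    (hmem : ∀ j : ℕ, 0 < j → j < p → e (Real.pi * j / p) ∈ S)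
    (hnot : ∀ θ, 0 < θ → θ < φ → Real.sin (p * θ) ≠ 0 →
      (∀ w, ε ≤ w → 2 < |2 * Real.cos (p * θ) + w * (Real.sin (p * θ) / Real.sin θ)|) → e θ ∉ S) :
    ((⌊p * φ / Real.pi⌋₊ - 1 : ℕ) : ℕ∞) ≤ (openGaps S (-3) (-3 + α)).encard := by
  have hp0 : (0 : ℝ) < p := by exact_mod_cast hp
  have hπ := Real.pi_pos
  set K := ⌊p * φ / Real.pi⌋₊ with hK
  rcases Nat.eq_zero_or_pos (K - 1) with h0 | h0
  · rw [h0]; simp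
  have hKφ : Real.pi * K / p ≤ φ := by
    have := Nat.floor_le (a := p * φ / Real.pi) (by positivity)
    rw [← hK, le_div_iff₀ hπ] at this
    rw [div_le_iff₀ hp0]
    linarith
  have hθ : ∀ j : ℕ, j ≤ K → Real.pi * j / p ≤ φ := by
    intro j hj
    refine le_trans ?_ hKφ
    have : (j : ℝ) ≤ K := by exact_mod_cast hj
    gcongr
  have hjp : ∀ j : ℕ, j ≤ K → j < p := by
    intro j hj
    have h1 := (hθ j hj).trans_lt hφ
    rw [div_lt_iff₀ hp0] at h1
    have : (j : ℝ) < p := lt_of_mul_lt_mul_left h1 hπ.le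
    exact_mod_cast this
  obtain ⟨δ, hδ0, hδπ, hδ⟩ := exists_angle hε
  have hθ0 : ∀ j : ℕ, 0 ≤ Real.pi * j / p := fun j => by positivity
  have hstep : ∀ j : ℕ, Real.pi * j / p < (Real.pi * j + δ) / p ∧
      (Real.pi * j + δ) / p < Real.pi * (j + 1 : ℕ) / p := by
    intro j
    constructor
    · gcongr; linarith
    · gcongr; push_cast; linarith
  -- The edges are the angles `πj/p` with `1 ≤ j ≤ K`; `j = 0` is skipped because its sine wave
  -- vanishes identically. The `K - 1` intervals between them each contain a point off `S`, at
  -- distance `δ/p` to the right of the left edge in the angle.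
  refine le_encard_openGaps (l := fun j => e (Real.pi * (j + 1 : ℕ) / p))
    (e := fun j => e ((Real.pi * (j + 1 : ℕ) + δ) / p)) hS ?_ ?_ ?_ ?_
  · exact fun j hj => hmem _ (by omega) (hjp _ (by omega))
  · intro j hj
    have h1 := hstep (j + 1)
    have h2 := hθ (j + 1 + 1) (by omega)
    have h3 := hθ (j + 1) (by omega)
    have h4 := hθ0 (j + 1)
    refine ⟨?_, he ⟨h4, by linarith⟩ ⟨by linarith, by linarith⟩ h1.1,
      he ⟨by linarith, by linarith⟩ ⟨by linarith, by linarith⟩ h1.2⟩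
    have e1 : (p : ℝ) * ((Real.pi * (j + 1 : ℕ) + δ) / p) = δ + (j + 1 : ℕ) * Real.pi := by
      field_simp; ring
    have hsδ : 0 < Real.sin δ := Real.sin_pos_of_pos_of_lt_pi hδ0 hδπ
    have hsq : ((-1 : ℝ) ^ (j + 1)) ≠ 0 := pow_ne_zero _ (by norm_num)
    refine hnot _ (by linarith) (by linarith) ?_ ?_
    · rw [e1, Real.sin_add_nat_mul_pi]
      exact mul_ne_zero hsq hsδ.ne'
    · intro w hw
      set θ := (Real.pi * (j + 1 : ℕ) + δ) / p with hθdef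
      rw [e1, Real.sin_add_nat_mul_pi, Real.cos_add_nat_mul_pi]
      have hsθ : 0 < Real.sin θ := Real.sin_pos_of_pos_of_lt_pi (by linarith) (by linarith)
      -- The shift by `(j + 1)π` only contributes a sign, and division by `sin θ ≤ 1` only increases
      -- the comb term.
      have e2 : 2 * ((-1) ^ (j + 1) * Real.cos δ) + w * ((-1) ^ (j + 1) * Real.sin δ / Real.sin θ) =
          (-1) ^ (j + 1) * (2 * Real.cos δ + w * (Real.sin δ / Real.sin θ)) := by ring
      rw [e2, abs_mul, abs_pow, abs_neg, abs_one, one_pow, one_mul]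
      have h5 : Real.sin δ ≤ Real.sin δ / Real.sin θ := by
        rw [le_div_iff₀ hsθ]
        nlinarith [Real.sin_le_one θ]
      have h6 : ε * Real.sin δ ≤ w * (Real.sin δ / Real.sin θ) :=
        mul_le_mul hw h5 hsδ.le (by linarith)
      exact lt_of_lt_of_le (by linarith) (le_abs_self _)
  · intro j hj
    have h3 := hθ (j + 1) (by omega)
    rw [← he0]
    exact he.monotoneOn ⟨le_rfl, hπ.le⟩ ⟨hθ0 _, by linarith⟩ (hθ0 _)
  · intro j hj
    have h3 := hθ (j + 1) (by omega)
    rw [← heφ]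
    exact he.monotoneOn ⟨hθ0 _, by linarith⟩ ⟨hφ0, hφ.le⟩ h3

lemma sin_mul_eq_zero_of_dvd {p j : ℕ} (hp : 1 ≤ p) {n : ℤ} (hn : (p : ℤ) ∣ n) :
    Real.sin (n * (Real.pi * j / p)) = 0 := by
  have hp0 : (p : ℝ) ≠ 0 := by exact_mod_cast (by omega : p ≠ 0)
  obtain ⟨k, rfl⟩ := hn
  rw [show ((p * k : ℤ) : ℝ) * (Real.pi * j / p) = ((k * j : ℤ) : ℝ) * Real.pi by
    push_cast; field_simp]
  exact Real.sin_int_mul_pi _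

lemma sin_pi_mul_div_ne_zero {p j : ℕ} (hj : 0 < j) (hjp : j < p) :
    Real.sin (Real.pi * j / p) ≠ 0 := by
  have hp0 : (0 : ℝ) < p := by exact_mod_cast (by omega : 0 < p)
  have hj' : (0 : ℝ) < j := by exact_mod_cast hj
  have hjp' : (j : ℝ) < p := by exact_mod_cast hjp
  have hπ := Real.pi_pos
  refine (Real.sin_pos_of_pos_of_lt_pi (by positivity) ?_).ne'
  rw [div_lt_iff₀ hp0]
  gcongr

variable {N : ℕ} [NeZero N]

/-- Bounded solutions of the one-dimensional equations force their energy into the spectrum. -/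
lemma mem_realSpectrum_of_solution {t : Fin 3 → ℤ × ZMod N} (ht : ∀ i, |(t i).1| ≤ 1)
    {V₀ V₁ : ℤ → ℝ} {T T₀ : L2 (Vertex N) →L[ℂ] L2 (Vertex N)} (hT : IsTube t V₀ V₁ T)
    (hT₀ : IsTube t 0 0 T₀) {A B : ℤ → ℝ} {C E : ℝ} (hA : ∀ n, |A n| ≤ C) (hB : ∀ n, |B n| ≤ C)
    (hE₀ : ∀ n, ∑ i, B (n + (t i).1) + V₀ n * A n = E * A n)
    (hE₁ : ∀ n, ∑ i, A (n - (t i).1) + V₁ n * B n = E * B n) {m : ℤ} (hm : A m ≠ 0) :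
    E ∈ realSpectrum T := by
  refine mem_realSpectrum_of_bounded ht hT hT₀ (C := C)
    (f := fun ω => ((if ω.2.1 = 0 then A ω.1 else B ω.1 : ℝ) : ℂ)) ?_ ?_ ?_
  · intro ω
    rw [Complex.norm_real, Real.norm_eq_abs]
    split_ifs
    · exact hA _
    · exact hB _
  · intro h
    have := congrFun h (m, 0, 0)
    simp only [if_true, Pi.zero_apply, Complex.ofReal_eq_zero] at this
    exact hm this
  · rintro ⟨n, j, k⟩
    fin_cases j
    · simp only [Fin.zero_eta, tubeFun_zero, Fin.isValue, one_ne_zero, if_false, if_true]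
      exact_mod_cast hE₀ n
    · simp only [Fin.mk_one, tubeFun_one, Fin.isValue, one_ne_zero, if_false, if_true]
      exact_mod_cast hE₁ n

section Armchair

/-- The potential with value `ε` on the atoms over `p ℤ`. -/
def armchairComb (p : ℕ) (ε : ℝ) : BddSeq := combSeq {n | (p : ℤ) ∣ n / 2} ε

lemma armchairComb_even (p : ℕ) (ε : ℝ) (n : ℤ) :
    armchairComb p ε (2 * n) = if (p : ℤ) ∣ n then ε else 0 := by
  classical
  rw [armchairComb, combSeq_apply, Set.indicator_apply]
  simp

lemma armchairComb_odd (p : ℕ) (ε : ℝ) (n : ℤ) :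
    armchairComb p ε (2 * n + 1) = if (p : ℤ) ∣ n then ε else 0 := by
  classical
  rw [armchairComb, combSeq_apply, Set.indicator_apply]
  have : (2 * n + 1) / 2 = n := by omega
  simp [this]

lemma armchairComb_periodic (p : ℕ) (ε : ℝ) (n : ℤ) :
    armchairComb p ε (n + 2 * (p : ℤ)) = armchairComb p ε n := by
  classical
  rw [armchairComb, combSeq_apply, combSeq_apply, Set.indicator_apply, Set.indicator_apply]
  have : (n + 2 * (p : ℤ)) / 2 = n / 2 + p := by omega
  simp [this]

/-- The wave `sin (nθ)` vanishes on `p ℤ` and does not feel the comb; the opposite sign on the other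
sublattice selects the low energy. -/
lemma armchair_edge_mem {p : ℕ} {ε : ℝ} {j : ℕ} (hj : 0 < j) (hjp : j < p) :
    -1 - 2 * Real.cos (Real.pi * j / p) ∈
      realSpectrum (armchairHamiltonian N (armchairComb p ε)) := by
  set θ := Real.pi * j / p with hθ
  have h1 : ∀ n : ℤ, (if (p : ℤ) ∣ n then ε else 0) * Real.sin (n * θ) = 0 := by
    intro n
    split_ifs with h
    · rw [sin_mul_eq_zero_of_dvd (by omega) h, mul_zero]
    · rw [zero_mul]
  have h2 : ∀ n : ℤ, Real.sin ((n + 1 : ℤ) * θ) + Real.sin ((n - 1 : ℤ) * θ) =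
      2 * Real.cos θ * Real.sin (n * θ) := by
    intro n
    rw [show ((n + 1 : ℤ) : ℝ) * θ = n * θ + θ by push_cast; ring,
      show ((n - 1 : ℤ) : ℝ) * θ = n * θ - θ by push_cast; ring, Real.sin_add, Real.sin_sub]
    ring
  refine mem_realSpectrum_of_solution goodBonds_armchair.abs_le (isTube_armchair _)
    isTube_armchair_zero (A := fun n => Real.sin (n * θ)) (B := fun n => -Real.sin (n * θ)) (C := 1)
    (fun n => Real.abs_sin_le_one _) (fun n => by rw [abs_neg]; exact Real.abs_sin_le_one _)
    (fun n => ?_) (fun n => ?_) (m := 1) (by simpa using sin_pi_mul_div_ne_zero hj hjp)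
  · rw [armchairComb_even, h1, Fin.sum_univ_three]
    simp only [armchairBonds, Matrix.cons_val_zero, Matrix.cons_val_one, Matrix.cons_val,
      ← sub_eq_add_neg, add_zero]
    linarith [h2 n]
  · rw [armchairComb_odd, mul_neg, h1, Fin.sum_univ_three]
    simp only [armchairBonds, Matrix.cons_val_zero, Matrix.cons_val_one, Matrix.cons_val,
      sub_neg_eq_add, sub_zero]
    linarith [h2 n]

/-- The comb takes equal values on the two sublattices, so `A + B` and `A - B` decouple. The sum
obeys a recurrence with coefficient at least `3` in modulus and vanishes; the difference obeys
Kronig–Penney with `w = ε`. -/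
lemma armchair_gap {p : ℕ} (hp : 1 ≤ p) {ε : ℝ} (hε : 0 < ε) {θ : ℝ}
    (hE : -1 - 2 * Real.cos θ + ε < -3 + loss N) (hs : Real.sin (p * θ) ≠ 0)
    (hD : 2 < |2 * Real.cos (p * θ) + ε * (Real.sin (p * θ) / Real.sin θ)|) :
    -1 - 2 * Real.cos θ ∉ realSpectrum (armchairHamiltonian N (armchairComb p ε)) := by
  intro hmem
  have : NeZero p := ⟨by omega⟩
  set E := -1 - 2 * Real.cos θ with hEdef
  have hnorm := norm_combSeq_le {n : ℤ | (p : ℤ) ∣ n / 2} hε.le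
  obtain ⟨ζ, C, A, B, hζ, hA, hB, hCA, hCB, h0, h1, hne⟩ := exists_bloch_solution (p := p)
    goodBonds_armchair
    (fun n => by
      have := armchairComb_periodic p ε (2 * n)
      rwa [← mul_add] at this)
    (fun n => by
      have := armchairComb_periodic p ε (2 * n + 1)
      rwa [show 2 * n + 1 + 2 * (p : ℤ) = 2 * (n + p) + 1 by ring] at this)
    (isTube_armchair (armchairComb p ε)) hε.le (fun n => (abs_apply_le_norm _ _).trans hnorm)
    (fun n => (abs_apply_le_norm _ _).trans hnorm) hE hmem
  simp only [armchairComb_even, armchairComb_odd, Fin.sum_univ_three, armchairBonds,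
    Matrix.cons_val_zero, Matrix.cons_val_one, Matrix.cons_val, ← sub_eq_add_neg, add_zero,
    sub_neg_eq_add, sub_zero] at h0 h1
  have hloss := loss_le (N := N)
  have hsum := eq_zero_of_contraction (u := fun n => A n + B n) (C := C + C)
    (q := fun n => E - 1 - if (p : ℤ) ∣ n then ε else 0)
    (fun n => (norm_add_le _ _).trans (add_le_add (hCA n) (hCB n)))
    (fun n => by
      rw [abs_of_neg] <;> split_ifs <;> linarith)
    (fun n => by
      push_cast
      linear_combination h0 n + h1 n)
  have hdiff := eq_zero_of_kronigPenney hp (u := fun n => A n - B n) hζ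
    (fun n => by simp only [hA, hB]; ring) (w := ε) (θ := θ)
    (fun n => by
      have e1 : (E : ℂ) = -1 - 2 * (Real.cos θ : ℝ) := by rw [hEdef]; push_cast; ring
      have h0' := h0 n
      have h1' := h1 n
      rw [e1] at h0' h1'
      rw [Complex.ofReal_add, Complex.ofReal_mul, Complex.ofReal_ofNat]
      linear_combination h1' - h0') hs hD
  refine hne ⟨fun n => ?_, fun n => ?_⟩
  · linear_combination (hsum n + hdiff n) / 2
  · linear_combination (hsum n - hdiff n) / 2

end Armchair

section Zigzag

/-- The potential with value `ε` at the atoms of type `0` over `p ℤ`. -/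
def zigzagComb (p : ℕ) (ε : ℝ) : BddSeq := combSeq {n | 2 * (p : ℤ) ∣ n - 1} ε

lemma zigzagComb_odd (p : ℕ) (ε : ℝ) (n : ℤ) :
    zigzagComb p ε (2 * n + 1) = if (p : ℤ) ∣ n then ε else 0 := by
  classical
  rw [zigzagComb, combSeq_apply, Set.indicator_apply]
  have h : 2 * n + 1 ∈ {n | 2 * (p : ℤ) ∣ n - 1} ↔ (p : ℤ) ∣ n := by
    change 2 * (p : ℤ) ∣ 2 * n + 1 - 1 ↔ _
    rw [add_sub_cancel_right, mul_dvd_mul_iff_left (by norm_num)]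
  simp only [h]

lemma zigzagComb_even (p : ℕ) (ε : ℝ) (n : ℤ) : zigzagComb p ε (2 * n) = 0 := by
  rw [zigzagComb, combSeq_apply, Set.indicator_of_notMem]
  intro h
  have h1 : (2 : ℤ) ∣ 2 * n - 1 := (Dvd.intro _ rfl).trans h
  omega

lemma zigzagComb_periodic (p : ℕ) (ε : ℝ) (n : ℤ) :
    zigzagComb p ε (n + 2 * (p : ℤ)) = zigzagComb p ε n := by
  classical
  rw [zigzagComb, combSeq_apply, combSeq_apply, Set.indicator_apply, Set.indicator_apply]
  simp only [mem_ofPred_eq, add_sub_right_comm, dvd_add_self_right]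

/-- Again `A` vanishes on the comb, which sits on atoms of type `0` only; `B` is solved from the
unperturbed equation on type `1`. -/
lemma zigzag_edge_mem {p : ℕ} {ε : ℝ} {j : ℕ} (hj : 0 < j) (hjp : j < p) :
    -Real.sqrt (5 + 4 * Real.cos (Real.pi * j / p)) ∈
      realSpectrum (zigzagHamiltonian N (zigzagComb p ε)) := by
  set θ := Real.pi * j / p with hθ
  set E := -Real.sqrt (5 + 4 * Real.cos θ) with hE
  have hcos := Real.neg_one_le_cos θ
  have hEsq : E * E = 5 + 4 * Real.cos θ := by
    rw [hE, neg_mul_neg, Real.mul_self_sqrt (by linarith)]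
  have hE1 : E ≤ -1 := by
    rw [hE, neg_le_neg_iff, Real.one_le_sqrt]
    linarith
  have hE0 : E ≠ 0 := by linarith
  have h1 : ∀ n : ℤ, (if (p : ℤ) ∣ n then ε else 0) * Real.sin (n * θ) = 0 := by
    intro n
    split_ifs with h
    · rw [sin_mul_eq_zero_of_dvd (by omega) h, mul_zero]
    · rw [zero_mul]
  have h2 : ∀ n : ℤ, Real.sin ((n + 1 : ℤ) * θ) + Real.sin ((n - 1 : ℤ) * θ) =
      2 * Real.cos θ * Real.sin (n * θ) := by
    intro n
    rw [show ((n + 1 : ℤ) : ℝ) * θ = n * θ + θ by push_cast; ring,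
      show ((n - 1 : ℤ) : ℝ) * θ = n * θ - θ by push_cast; ring, Real.sin_add, Real.sin_sub]
    ring
  refine mem_realSpectrum_of_solution goodBonds_zigzag.abs_le (isTube_zigzag _)
    isTube_zigzag_zero (A := fun n => Real.sin (n * θ))
    (B := fun n => (2 * Real.sin ((n + 1 : ℤ) * θ) + Real.sin (n * θ)) / E) (C := 3)
    (fun n => (Real.abs_sin_le_one _).trans (by norm_num)) (fun n => ?_)
    (fun n => ?_) (fun n => ?_) (m := 1) (by simpa using sin_pi_mul_div_ne_zero hj hjp)
  · rw [abs_div, div_le_iff₀ (abs_pos.2 hE0), abs_of_neg (by linarith : E < 0)]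
    have h3 := abs_le.1 (Real.abs_sin_le_one ((n + 1 : ℤ) * θ))
    have h4 := abs_le.1 (Real.abs_sin_le_one (n * θ))
    rw [abs_le]
    constructor <;> linarith
  · rw [zigzagComb_odd, h1, Fin.sum_univ_three]
    simp only [zigzagBonds, Matrix.cons_val_zero, Matrix.cons_val_one, Matrix.cons_val,
      ← sub_eq_add_neg, add_zero, sub_add_cancel]
    have h3 := h2 n
    generalize Real.sin ((n + 1 : ℤ) * θ) = a at h3 ⊢
    generalize Real.sin ((n - 1 : ℤ) * θ) = b at h3 ⊢
    generalize Real.sin (n * θ) = c at h3 ⊢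
    field_simp
    rw [sq, hEsq]
    linarith
  · rw [zigzagComb_even, zero_mul, Fin.sum_univ_three]
    simp only [zigzagBonds, Matrix.cons_val_zero, Matrix.cons_val_one, Matrix.cons_val,
      sub_neg_eq_add, sub_zero]
    field_simp
    ring

lemma zigzag_gap {p : ℕ} (hp : 1 ≤ p) {ε : ℝ} (hε : 0 < ε) {θ : ℝ}
    (hE : -Real.sqrt (5 + 4 * Real.cos θ) + ε < -3 + loss N) (hs : Real.sin (p * θ) ≠ 0)
    (hD : ∀ w, ε ≤ w → 2 < |2 * Real.cos (p * θ) + w * (Real.sin (p * θ) / Real.sin θ)|) :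
    -Real.sqrt (5 + 4 * Real.cos θ) ∉ realSpectrum (zigzagHamiltonian N (zigzagComb p ε)) := by
  intro hmem
  have : NeZero p := ⟨by omega⟩
  have hEsq : (-Real.sqrt (5 + 4 * Real.cos θ)) * (-Real.sqrt (5 + 4 * Real.cos θ)) =
      5 + 4 * Real.cos θ := by
    rw [neg_mul_neg, Real.mul_self_sqrt (by linarith [Real.neg_one_le_cos θ])]
  set E := -Real.sqrt (5 + 4 * Real.cos θ)
  have hnorm := norm_combSeq_le {n : ℤ | 2 * (p : ℤ) ∣ n - 1} hε.le
  obtain ⟨ζ, C, A, B, hζ, hA, hB, hCA, hCB, h0, h1, hne⟩ := exists_bloch_solution (p := p)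
    goodBonds_zigzag
    (fun n => by
      have := zigzagComb_periodic p ε (2 * n + 1)
      rwa [show 2 * n + 1 + 2 * (p : ℤ) = 2 * (n + p) + 1 by ring] at this)
    (fun n => by
      have := zigzagComb_periodic p ε (2 * (n + 1))
      rwa [show 2 * (n + 1) + 2 * (p : ℤ) = 2 * (n + p + 1) by ring] at this)
    (isTube_zigzag (zigzagComb p ε)) hε.le (fun n => (abs_apply_le_norm _ _).trans hnorm)
    (fun n => (abs_apply_le_norm _ _).trans hnorm) hE hmem
  simp only [zigzagComb_even, zigzagComb_odd, Fin.sum_univ_three, zigzagBonds,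
    Matrix.cons_val_zero, Matrix.cons_val_one, Matrix.cons_val, ← sub_eq_add_neg, add_zero,
    sub_neg_eq_add, sub_zero, Complex.ofReal_zero, zero_mul] at h0 h1
  have hloss := loss_le (N := N)
  have hE2 : E < -2 := by linarith
  have hEc : (E : ℂ) * E = 5 + 4 * (Real.cos θ : ℝ) := by
    rw [← Complex.ofReal_mul, hEsq]; push_cast; ring
  -- Elimination of `B` leaves a Kronig–Penney recurrence for `A` of strength `-Eε/2`, at least `ε`
  -- because `E < -2`. This energy-dependent strength is why `hD` ranges over all `w ≥ ε`.
  have hzero := eq_zero_of_kronigPenney hp (u := A) hζ hA (w := -E / 2 * ε) (θ := θ)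
    (fun n => by
      have e0 := h0 n
      have e1 := h1 n
      have e2 := h1 (n - 1)
      rw [sub_add_cancel] at e2
      have e3 : ((2 * Real.cos θ + if (p : ℤ) ∣ n then -E / 2 * ε else 0 : ℝ) : ℂ) =
          2 * (Real.cos θ : ℝ) - E / 2 * ((if (p : ℤ) ∣ n then ε else 0 : ℝ) : ℂ) := by
        split_ifs
        · rw [Complex.ofReal_add, Complex.ofReal_mul, Complex.ofReal_mul]; push_cast; ring
        · rw [Complex.ofReal_add, Complex.ofReal_mul]; push_cast; ring
      rw [e3]
      linear_combination E / 2 * e0 + e2 + e1 / 2 + A n / 2 * hEc) hs (hD _ (by nlinarith))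
  refine hne ⟨hzero, fun n => ?_⟩
  have e1 := h1 n
  rw [hzero, hzero] at e1
  have hE0 : (E : ℂ) ≠ 0 := by
    have : E ≠ 0 := by linarith
    exact_mod_cast this
  have e2 : (E : ℂ) * B n = 0 := by rw [← e1]; ring
  simpa [hE0] using e2

end Zigzag

/-- Gap numbers within a bounded distance of `p φ / π` give the asymptotics. -/
lemma exists_gapNumbers_isLittleO {ι : Type} {H : BddSeq → (L2 ι →L[ℂ] L2 ι)} {α φ : ℝ}
    (h : ∀ p : ℕ, 1 ≤ p → ∃ (ub : ℕ) (G : ℕ), IsMaxEdgeGapNumber H p α G ∧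
      ⌊p * φ / Real.pi⌋₊ - 1 ≤ G ∧ G ≤ ub + 1 ∧ (ub : ℝ) ≤ p / Real.pi * φ + 2) :
    ∃ G : ℕ → ℕ, (∀ p : ℕ, 1 ≤ p → IsMaxEdgeGapNumber H p α (G p)) ∧
      (fun p : ℕ => (G p : ℝ) - (p : ℝ) / Real.pi * φ) =o[atTop] fun p : ℕ => (p : ℝ) := by
  -- The `3` is `1 + 2` from above; from below, the floor and the subtracted `1` cost less than `2`.
  have h' : ∀ p : ℕ, ∃ G : ℕ, 1 ≤ p → IsMaxEdgeGapNumber H p α G ∧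
      |(G : ℝ) - (p : ℝ) / Real.pi * φ| ≤ 3 := by
    intro p
    by_cases hp : 1 ≤ p
    · obtain ⟨ub, G, h1, h2, h3, h4⟩ := h p hp
      refine ⟨G, fun _ => ⟨h1, ?_⟩⟩
      have h5 : (⌊p * φ / Real.pi⌋₊ : ℝ) ≤ G + 1 := by
        exact_mod_cast (by omega : ⌊p * φ / Real.pi⌋₊ ≤ G + 1)
      have h6 : (G : ℝ) ≤ ub + 1 := by exact_mod_cast h3
      have h7 := Nat.lt_floor_add_one (p * φ / Real.pi)
      have h8 : p * φ / Real.pi = p / Real.pi * φ := by ring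
      rw [h8] at h5 h7
      rw [abs_le]
      constructor <;> linarith
    · exact ⟨0, fun h => absurd h hp⟩
  choose G hG using h'
  refine ⟨G, fun p hp => (hG p hp).1, ?_⟩
  have h1 : (fun p : ℕ => (G p : ℝ) - (p : ℝ) / Real.pi * φ) =O[atTop] fun _ : ℕ => (1 : ℝ) := by
    refine IsBigO.of_bound 3 ?_
    filter_upwards [eventually_ge_atTop 1] with p hp
    rw [Real.norm_eq_abs, norm_one, mul_one]
    exact (hG p hp).2
  exact h1.trans_isLittleO (isLittleO_const_left.2 (Or.inr
    (tendsto_norm_atTop_atTop.comp tendsto_natCast_atTop_atTop)))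

end Nanotube

end

/-! ### Assembly of the two bounds. -/

noncomputable section

namespace Nanotube

variable {N : ℕ} [NeZero N]

/-- Upper and lower bounds for the gaps of a tube determine its gap number up to a constant. -/
lemma exists_isMaxEdgeGapNumber_of_tube {H : BddSeq → (L2 (Vertex N) →L[ℂ] L2 (Vertex N))}
    {t : Fin 3 → ℤ × ZMod N} (ht : GoodBonds t) {i₀ i₁ : ℤ → ℤ}
    (hi₀ : ∀ n m, i₀ (n + m) = i₀ n + 2 * m) (hi₁ : ∀ n m, i₁ (n + m) = i₁ n + 2 * m)
    (hH : ∀ v, IsTube t (fun n => v (i₀ n)) (fun n => v (i₁ n)) (H v))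
    {p : ℕ} [NeZero p] {α φ c : ℝ} (hα' : α < loss N) (hc : -1 < c) (hc' : c ≤ 1)
    (hφ : φ = Real.arccos c)
    (hsymbol : ∀ l : ZMod p, 3 - α ≤ ‖symbol t (l, (0 : ZMod N))‖ ↔
      c ≤ Real.cos (2 * Real.pi * l.val / p))
    {e : ℝ → ℝ} (he : StrictMonoOn e (Icc 0 Real.pi)) (he0 : e 0 = -3) (heφ : e φ = -3 + α)
    {comb : ℝ → BddSeq} (hcomb : ∀ ε, 0 < ε → ‖comb ε‖ ≤ ε)
    (hper : ∀ ε n, comb ε (n + 2 * (p : ℤ)) = comb ε n)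
    (hmem : ∀ ε, ∀ j : ℕ, 0 < j → j < p → e (Real.pi * j / p) ∈ realSpectrum (H (comb ε)))
    (hgap : ∀ ε θ, 0 < ε → e θ + ε < -3 + loss N → Real.sin (p * θ) ≠ 0 →
      (∀ w, ε ≤ w → 2 < |2 * Real.cos (p * θ) + w * (Real.sin (p * θ) / Real.sin θ)|) →
      e θ ∉ realSpectrum (H (comb ε))) :
    ∃ (ub : ℕ) (G : ℕ), IsMaxEdgeGapNumber H p α G ∧ ⌊p * φ / Real.pi⌋₊ - 1 ≤ G ∧ G ≤ ub + 1 ∧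
      (ub : ℝ) ≤ p / Real.pi * φ + 2 := by
  have hp : 1 ≤ p := NeZero.one_le
  have hzero : IsTube t 0 0 (H 0) := hH 0
  obtain ⟨ε₁, hε₁, hub⟩ := encard_openGaps_tube_le (p := p) ht hzero hα'
  have hφ0 : 0 ≤ φ := hφ ▸ Real.arccos_nonneg c
  have hφπ : φ < Real.pi := by
    rw [hφ]
    refine lt_of_le_of_ne (Real.arccos_le_pi c) fun h => ?_
    rw [Real.arccos_eq_pi] at h
    linarith
  set ub := Nat.card {l : ZMod p // 3 - α ≤ ‖symbol t (l, (0 : ZMod N))‖} with hubdef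
  have hcard : (ub : ℝ) ≤ p / Real.pi * φ + 2 := by
    rw [hubdef, hφ]
    simp_rw [hsymbol]
    exact natCard_cos_ge_le hc.le hc'
  -- The second entry ensures `e θ + ε < -3 + loss N` whenever `θ < φ`, so that the reduction to one
  -- dimension applies.
  have hδ : 0 < min ε₁ (loss N - α) := lt_min hε₁ (by linarith)
  obtain ⟨G, hG, hG1, hG2⟩ := exists_isMaxEdgeGapNumber (H := H) (p := p) (α := α) hδ
    (lb := ⌊p * φ / Real.pi⌋₊ - 1) (ub := ub + 1)
    (fun v hv hvn => by
      have hb : ∀ n, |v n| ≤ ε₁ := fun n =>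
        (abs_apply_le_norm v n).trans (hvn.trans (min_le_left _ _))
      exact hub _ _ _ (fun n => by simp only [hi₀, hv]) (fun n => by simp only [hi₁, hv])
        (fun n => hb _) (fun n => hb _) (hH v))
    (fun ε hε hε' => by
      refine ⟨comb ε, hper ε, hcomb ε hε, ?_⟩
      refine le_encard_openGaps_of_dispersion (isClosed_realSpectrum _) hφ0 hφπ he he0 heφ hp hε
        (hmem ε) fun θ h0 h1 hs hD => hgap ε θ hε ?_ hs hD
      have h2 : e θ < e φ := he ⟨h0.le, by linarith⟩ ⟨hφ0, hφπ.le⟩ h1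
      have h3 := hε'.trans (min_le_right _ _)
      linarith)
  exact ⟨ub, G, hG, hG1, hG2, hcard⟩

lemma strictMonoOn_armchair : StrictMonoOn (fun θ => -1 - 2 * Real.cos θ) (Icc 0 Real.pi) :=
  fun _ hx _ hy hxy => by
    have := Real.strictAntiOn_cos hx hy hxy
    simp only
    linarith

lemma strictMonoOn_zigzag :
    StrictMonoOn (fun θ => -Real.sqrt (5 + 4 * Real.cos θ)) (Icc 0 Real.pi) :=
  fun x hx y hy hxy => by
    have := Real.strictAntiOn_cos hx hy hxy
    have := Real.neg_one_le_cos y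
    exact neg_lt_neg (Real.sqrt_lt_sqrt (by linarith) (by linarith))

lemma armchair_gapNumbers {α : ℝ} (hα : 0 < α) (hα' : α < loss N) {p : ℕ} (hp : 1 ≤ p) :
    ∃ (ub : ℕ) (G : ℕ), IsMaxEdgeGapNumber (armchairHamiltonian N) p α G ∧
      ⌊p * Real.arccos (1 - α / 2) / Real.pi⌋₊ - 1 ≤ G ∧ G ≤ ub + 1 ∧
      (ub : ℝ) ≤ p / Real.pi * Real.arccos (1 - α / 2) + 2 := by
  have : NeZero p := ⟨by omega⟩
  have hloss := loss_le (N := N)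
  refine exists_isMaxEdgeGapNumber_of_tube goodBonds_armchair (i₀ := fun n => 2 * n)
    (i₁ := fun n => 2 * n + 1) (fun n m => by ring) (fun n m => by ring) isTube_armchair hα'
    (c := 1 - α / 2) (by linarith) (by linarith) rfl (fun l => ?_) strictMonoOn_armchair
    (by norm_num) ?_ (comb := armchairComb p) (fun ε hε => norm_combSeq_le _ hε.le)
    (armchairComb_periodic p) (fun ε j hj hjp => armchair_edge_mem hj hjp)
    (fun ε θ hε hE hs hD => armchair_gap hp hε hE hs (hD ε le_rfl))
  · rw [symbol_armchair, Complex.norm_real, Real.norm_eq_abs, le_abs]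
    have := Real.neg_one_le_cos (2 * Real.pi * l.val / p)
    constructor
    · rintro (h | h) <;> linarith
    · intro h
      left
      linarith
  · rw [Real.cos_arccos (by linarith) (by linarith)]
    ring

lemma zigzag_gapNumbers {α : ℝ} (hα : 0 < α) (hα' : α < loss N) {p : ℕ} (hp : 1 ≤ p) :
    ∃ (ub : ℕ) (G : ℕ), IsMaxEdgeGapNumber (zigzagHamiltonian N) p α G ∧
      ⌊p * Real.arccos (1 - (6 * α - α ^ 2) / 4) / Real.pi⌋₊ - 1 ≤ G ∧ G ≤ ub + 1 ∧
      (ub : ℝ) ≤ p / Real.pi * Real.arccos (1 - (6 * α - α ^ 2) / 4) + 2 := by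
  have : NeZero p := ⟨by omega⟩
  have hloss := loss_le (N := N)
  refine exists_isMaxEdgeGapNumber_of_tube goodBonds_zigzag (i₀ := fun n => 2 * n + 1)
    (i₁ := fun n => 2 * (n + 1)) (fun n m => by ring) (fun n m => by ring) isTube_zigzag hα'
    (c := 1 - (6 * α - α ^ 2) / 4) (by nlinarith) (by nlinarith) rfl (fun l => ?_)
    strictMonoOn_zigzag ?_ ?_ (comb := zigzagComb p) (fun ε hε => norm_combSeq_le _ hε.le)
    (zigzagComb_periodic p) (fun ε j hj hjp => zigzag_edge_mem hj hjp)
    (fun ε θ hε hE hs hD => zigzag_gap hp hε hE hs hD)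
  · rw [← sq_le_sq₀ (by linarith) (norm_nonneg _), norm_sq_symbol_zigzag]
    constructor <;> intro h <;> nlinarith
  · rw [Real.cos_zero, show (5 + 4 * 1 : ℝ) = 3 ^ 2 by norm_num, Real.sqrt_sq (by norm_num)]
  · rw [Real.cos_arccos (by nlinarith) (by nlinarith),
      show 5 + 4 * (1 - (6 * α - α ^ 2) / 4) = (3 - α) ^ 2 by ring, Real.sqrt_sq (by linarith)]
    ring

end Nanotube

end

theorem mainTheorem11 (N : ℕ) (hN : 1 ≤ N) :
    ∃ α₀ : ℝ, 0 < α₀ ∧ ∀ α : ℝ, 0 < α → α < α₀ →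
      (∃ Gar : ℕ → ℕ,
        (∀ p : ℕ, 1 ≤ p →
          Nanotube.IsMaxEdgeGapNumber (Nanotube.armchairHamiltonian N) p α (Gar p)) ∧
        (fun p : ℕ => (Gar p : ℝ) - (p : ℝ) / Real.pi * Real.arccos (1 - α / 2))
          =o[atTop] fun p : ℕ => (p : ℝ)) ∧
      (∃ Gzi : ℕ → ℕ,
        (∀ p : ℕ, 1 ≤ p →
          Nanotube.IsMaxEdgeGapNumber (Nanotube.zigzagHamiltonian N) p α (Gzi p)) ∧
        (fun p : ℕ =>
            (Gzi p : ℝ) - (p : ℝ) / Real.pi * Real.arccos (1 - (6 * α - α ^ 2) / 4))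
          =o[atTop] fun p : ℕ => (p : ℝ)) := by
  have : NeZero N := ⟨by omega⟩
  -- The threshold `α₀` is the loss: below `-3 + loss N` only functions constant around the tube
  -- matter.
  exact ⟨Nanotube.loss N, Nanotube.loss_pos, fun α hα hα' =>
    ⟨Nanotube.exists_gapNumbers_isLittleO fun _ hp => Nanotube.armchair_gapNumbers hα hα' hp,
      Nanotube.exists_gapNumbers_isLittleO fun _ hp => Nanotube.zigzag_gapNumbers hα hα' hp⟩⟩
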